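/- Let $n\ge 2$ be an integer, $1<p\le n$, let $\Omega\subset\mathbb{R}^n$ be a bounded open set, let $\Gamma$ be a closed (possibly empty) subset of $\partial\Omega$, and let $\delta_\Gamma(x)=\operatorname{dist}(x,\Gamma)$ (with $\delta_\emptyset\equiv\infty$). Let $\mathcal{A}\colon\Omega\times\mathbb{R}^n\to\mathbb{R}^n$ be such that $\mathcal{A}(\cdot,z)$ is measurable for each $z$, $\mathcal{A}(x,\cdot)$ is continuous for each $x$, and, for some $1\le L<\infty$, $$\mathcal{A}(x,z)\cdot z\ge|z|^p,\qquad |\mathcal{A}(x,z)|\le L|z|^{p-1},\qquad (\mathcal{A}(x,z_1)-\mathcal{A}(x,z_2))\cdot(z_1-z_2)>0$$ for all $x\in\Omega$ and $z,z_1,z_2\in\mathbb{R}^n$ with $z_1\ne z_2$. Let $\nu=\nu_+-\nu_-$, where $\nu_\pm$ are nonnegative Radon measures on $\Omega$ (finite on compact subsets of $\Omega$), and let $\beta>0$. *Function spaces.* $W^{1,p}_0(\Omega)$ is the closure of $C_c^\infty(\Omega)$ in $W^{1,p}(\Omega)$. $W^{1,p}_{\complement\Gamma}(\Omega)$ is the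 set of all $u\in W^{1,p}_{\mathrm{loc}}(\Omega)$ such that $u\varphi\in W^{1,p}_0(\Omega)$ for every $\varphi\in C^\infty(\mathbb{R}^n)$ vanishing on a neighborhood of $\Gamma$. $L^\infty_{\Gamma,\beta}(\Omega)$ is the set of all $u\in L^\infty(\Omega)$ with $\|u/\delta_\Gamma^\beta\|_{L^\infty(\Omega)}<\infty$. *Weak solutions.* $u\in W^{1,p}_{\mathrm{loc}}(\Omega)$ is a weak subsolution (supersolution) of $-\operatorname{div}\mathcal{A}(x,\nabla u)=\nu$ in $\Omega$ if $\int_\Omega\mathcal{A}(x,\nabla u)\cdot\nabla\varphi\,dx\le\int_\Omega\varphi\,d\nu$ (respectively $\ge$) for all $0\le\varphi\in C_c^\infty(\Omega)$, and a weak solution if equality holds for all $\varphi\in C_c^\infty(\Omega)$. *Capacities.* For compact $K\subset\Omega$ put $\mathrm{cap}_p(K,\Omega)=\inf\{\int|\nabla\varphi|^p\,dx:\varphi\in C_c^\infty(\Omega),\ \varphi\ge1\text{ on }K\}$, and for $E\subset\Omega$ put $\mathrm{cap}_p(E,\Omega)=\inf_{E\subset U\subset\Omega,\,U\text{ open}}\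 \sup_{K\subset U\text{ compact}}\mathrm{cap}_p(K,\Omega)$. A property holds quasi-everywhere (q.e.) on $\Omega$ if it holds outside a set $E\subset\Omega$ with $\mathrm{cap}_p(E,\Omega)=0$. An extended real valued function $u$ is $p$-quasicontinuous on $\Omega$ if for every $\epsilon>0$ there is an open set $G$ with $C_p(G)<\epsilon$ such that $u|_{\Omega\setminus G}$ is continuous, where $C_p(G)$ is the Sobolev capacity, the infimum of $\int_{\mathbb{R}^n}(|w|^p+|\nabla w|^p)\,dx$ over all $w\in W^{1,p}(\mathbb{R}^n)$ with $w\ge1$ a.e. on an open set containing $G$. **Theorem.** Let $u,v\in W^{1,p}_{\complement\Gamma}(\Omega)\cap L^\infty_{\Gamma,\beta}(\Omega)$ be $p$-quasicontinuous on $\Omega$. If $u$ is a weak subsolution and $v$ is a weak supersolution of $-\operatorname{div}\mathcal{A}(x,\nabla u)=\nu$ in $\Omega$, then $u\le v$ q.e. on $\Omega$. In particular, if $u$ and $v$ are both weak solutions, then $u=v$ q.e. on $\Omega$. -/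

import Mathlib

open MeasureTheory Set Filter Topology
open scoped ENNReal ContDiff

noncomputable section

namespace ComparisonPrinciple

/-- `φ ∈ C_c^∞(U)`: smooth, with compact support contained in `U`. -/
def IsTest {n : ℕ} (U : Set (EuclideanSpace ℝ (Fin n)))
    (φ : EuclideanSpace ℝ (Fin n) → ℝ) : Prop :=
  ContDiff ℝ ∞ φ ∧ HasCompactSupport φ ∧ tsupport φ ⊆ U

/-- `G` is the weak (distributional) gradient of `f` in the open set `U`. -/
def HasWeakGradient {n : ℕ} (U : Set (EuclideanSpace ℝ (Fin n)))
    (f : EuclideanSpace ℝ (Fin n) → ℝ)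
    (G : EuclideanSpace ℝ (Fin n) → EuclideanSpace ℝ (Fin n)) : Prop :=
  LocallyIntegrableOn f U volume ∧ LocallyIntegrableOn G U volume ∧
    ∀ φ : EuclideanSpace ℝ (Fin n) → ℝ, IsTest U φ →
      ∫ x in U, f x • gradient φ x = - ∫ x in U, φ x • G x

/-- `f ∈ W^{1,p}_loc(U)` with weak gradient `G`. -/
def HasLocSobolevGradient {n : ℕ} (p : ℝ) (U : Set (EuclideanSpace ℝ (Fin n)))
    (f : EuclideanSpace ℝ (Fin n) → ℝ)
    (G : EuclideanSpace ℝ (Fin n) → EuclideanSpace ℝ (Fin n)) : Prop :=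
  HasWeakGradient U f G ∧
    ∀ K : Set (EuclideanSpace ℝ (Fin n)), IsCompact K → K ⊆ U →
      MemLp f (ENNReal.ofReal p) (volume.restrict K) ∧
      MemLp G (ENNReal.ofReal p) (volume.restrict K)

/-- `f ∈ W^{1,p}_loc(U)`. -/
def MemW1pLoc {n : ℕ} (p : ℝ) (U : Set (EuclideanSpace ℝ (Fin n)))
    (f : EuclideanSpace ℝ (Fin n) → ℝ) : Prop :=
  ∃ G, HasLocSobolevGradient p U f G

/-- `f ∈ W^{1,p}_0(U)`: `f ∈ W^{1,p}(U)` is a limit in `W^{1,p}(U)` of functions in `C_c^∞(U)`.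
For bounded `U`, by the Poincaré inequality, this is the closure of `C_c^∞(U)` with respect to
the norm `‖∇ ·‖_{L^p(U)}`. -/
def MemW1pZero {n : ℕ} (p : ℝ) (U : Set (EuclideanSpace ℝ (Fin n)))
    (f : EuclideanSpace ℝ (Fin n) → ℝ) : Prop :=
  ∃ G : EuclideanSpace ℝ (Fin n) → EuclideanSpace ℝ (Fin n),
    HasWeakGradient U f G ∧
    MemLp f (ENNReal.ofReal p) (volume.restrict U) ∧
    MemLp G (ENNReal.ofReal p) (volume.restrict U) ∧
    ∃ φ : ℕ → EuclideanSpace ℝ (Fin n) → ℝ, (∀ k, IsTest U (φ k)) ∧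
      Tendsto (fun k => eLpNorm (fun x => φ k x - f x) (ENNReal.ofReal p) (volume.restrict U))
        atTop (𝓝 0) ∧
      Tendsto (fun k => eLpNorm (fun x => gradient (φ k) x - G x) (ENNReal.ofReal p)
        (volume.restrict U)) atTop (𝓝 0)

/-- `f ∈ W^{1,p}_{∁Γ}(Ω)`: `f ∈ W^{1,p}_loc(Ω)` and `f φ ∈ W^{1,p}_0(Ω)` for every smooth `φ`
that vanishes on a neighborhood of `Γ`. -/
def MemW1pCompl {n : ℕ} (p : ℝ) (Ω Γ : Set (EuclideanSpace ℝ (Fin n)))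
    (f : EuclideanSpace ℝ (Fin n) → ℝ) : Prop :=
  MemW1pLoc p Ω f ∧
    ∀ φ : EuclideanSpace ℝ (Fin n) → ℝ, ContDiff ℝ ∞ φ →
      (∃ V : Set (EuclideanSpace ℝ (Fin n)), IsOpen V ∧ Γ ⊆ V ∧ ∀ x ∈ V, φ x = 0) →
      MemW1pZero p Ω (fun x => f x * φ x)

/-- `u ∈ L^∞_{Γ,β}(Ω)`, for an extended real valued `u`: both `u` and `u / δ_Γ^β` are essentially
bounded on `Ω`. The distance `δ_Γ` takes values in `[0, ∞]`, and it is `∞` if `Γ` is empty. -/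
def MemLinftyWeighted {n : ℕ} (β : ℝ) (Ω Γ : Set (EuclideanSpace ℝ (Fin n)))
    (u : EuclideanSpace ℝ (Fin n) → EReal) : Prop :=
  AEMeasurable u (volume.restrict Ω) ∧
    essSup (fun x => (u x).abs) (volume.restrict Ω) < ⊤ ∧
    essSup (fun x => (u x).abs / Metric.infEDist x Γ ^ β) (volume.restrict Ω) < ⊤

/-- The variational `p`-capacity of a compact set `K` relative to the open set `U`. -/
def capCompact {n : ℕ} (p : ℝ) (K U : Set (EuclideanSpace ℝ (Fin n))) : ℝ≥0∞ :=
  ⨅ (φ : EuclideanSpace ℝ (Fin n) → ℝ) (_ : IsTest U φ) (_ : ∀ x ∈ K, 1 ≤ φ x),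
    ∫⁻ x, ‖gradient φ x‖ₑ ^ p

/-- The variational `p`-capacity of an arbitrary set `E ⊆ Ω` relative to the open set `Ω`. -/
def cap {n : ℕ} (p : ℝ) (E Ω : Set (EuclideanSpace ℝ (Fin n))) : ℝ≥0∞ :=
  ⨅ (U : Set (EuclideanSpace ℝ (Fin n))) (_ : IsOpen U) (_ : E ⊆ U) (_ : U ⊆ Ω),
    ⨆ (K : Set (EuclideanSpace ℝ (Fin n))) (_ : IsCompact K) (_ : K ⊆ U), capCompact p K Ω

/-- The property `P` holds `p`-quasieverywhere on `Ω`. -/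
def Quasieverywhere {n : ℕ} (p : ℝ) (Ω : Set (EuclideanSpace ℝ (Fin n)))
    (P : EuclideanSpace ℝ (Fin n) → Prop) : Prop :=
  cap p {x | x ∈ Ω ∧ ¬ P x} Ω = 0

/-- The Sobolev `p`-capacity `C_p(E)`: the infimum of `∫ |w|^p + |∇w|^p` over the Sobolev functions
`w` on the whole space with `w ≥ 1` almost everywhere on an open set containing `E`. -/
def sobolevCap {n : ℕ} (p : ℝ) (E : Set (EuclideanSpace ℝ (Fin n))) : ℝ≥0∞ :=
  ⨅ (w : EuclideanSpace ℝ (Fin n) → ℝ)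
    (G : EuclideanSpace ℝ (Fin n) → EuclideanSpace ℝ (Fin n))
    (_ : HasWeakGradient univ w G)
    (_ : ∃ U : Set (EuclideanSpace ℝ (Fin n)), IsOpen U ∧ E ⊆ U ∧
      ∀ᵐ x ∂(volume.restrict U), 1 ≤ w x),
    ∫⁻ x, (‖w x‖ₑ ^ p + ‖G x‖ₑ ^ p)

/-- `u` is `p`-quasicontinuous on `Ω`. -/
def IsQuasicontinuous {n : ℕ} (p : ℝ) (Ω : Set (EuclideanSpace ℝ (Fin n)))
    (u : EuclideanSpace ℝ (Fin n) → EReal) : Prop :=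
  ∀ ε : ℝ≥0∞, 0 < ε → ∃ G : Set (EuclideanSpace ℝ (Fin n)),
    IsOpen G ∧ sobolevCap p G < ε ∧ ContinuousOn u (Ω \ G)

/-- The structure conditions on `𝒜 : Ω × ℝⁿ → ℝⁿ` (`p`-Laplacian type operators). -/
structure IsPLaplaceType {n : ℕ} (p : ℝ) (Ω : Set (EuclideanSpace ℝ (Fin n)))
    (A : EuclideanSpace ℝ (Fin n) → EuclideanSpace ℝ (Fin n) → EuclideanSpace ℝ (Fin n)) :
    Prop where
  measurable : ∀ z, AEMeasurable (fun x => A x z) (volume.restrict Ω)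
  continuous : ∀ x ∈ Ω, Continuous (A x)
  coercive : ∀ x ∈ Ω, ∀ z, ‖z‖ ^ p ≤ inner ℝ (A x z) z
  growth : ∃ L : ℝ, 1 ≤ L ∧ ∀ x ∈ Ω, ∀ z, ‖A x z‖ ≤ L * ‖z‖ ^ (p - 1)
  monotone : ∀ x ∈ Ω, ∀ z₁ z₂, z₁ ≠ z₂ → 0 < inner ℝ (A x z₁ - A x z₂) (z₁ - z₂)

/-- `f` is a weak subsolution to `-div 𝒜(x, ∇f) = ν₊ - ν₋` in `Ω`. -/
def IsWeakSubsolution {n : ℕ} (p : ℝ) (Ω : Set (EuclideanSpace ℝ (Fin n)))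
    (A : EuclideanSpace ℝ (Fin n) → EuclideanSpace ℝ (Fin n) → EuclideanSpace ℝ (Fin n))
    (νp νm : Measure Ω) (f : EuclideanSpace ℝ (Fin n) → ℝ) : Prop :=
  ∃ G, HasLocSobolevGradient p Ω f G ∧
    ∀ φ : EuclideanSpace ℝ (Fin n) → ℝ, IsTest Ω φ → (∀ x, 0 ≤ φ x) →
      ∫ x in Ω, inner ℝ (A x (G x)) (gradient φ x) ≤ ∫ x : Ω, φ x ∂νp - ∫ x : Ω, φ x ∂νm

/-- `f` is a weak supersolution to `-div 𝒜(x, ∇f) = ν₊ - ν₋` in `Ω`. -/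
def IsWeakSupersolution {n : ℕ} (p : ℝ) (Ω : Set (EuclideanSpace ℝ (Fin n)))
    (A : EuclideanSpace ℝ (Fin n) → EuclideanSpace ℝ (Fin n) → EuclideanSpace ℝ (Fin n))
    (νp νm : Measure Ω) (f : EuclideanSpace ℝ (Fin n) → ℝ) : Prop :=
  ∃ G, HasLocSobolevGradient p Ω f G ∧
    ∀ φ : EuclideanSpace ℝ (Fin n) → ℝ, IsTest Ω φ → (∀ x, 0 ≤ φ x) →
      ∫ x : Ω, φ x ∂νp - ∫ x : Ω, φ x ∂νm ≤ ∫ x in Ω, inner ℝ (A x (G x)) (gradient φ x)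

/-- `f` is a weak solution to `-div 𝒜(x, ∇f) = ν₊ - ν₋` in `Ω`. -/
def IsWeakSolution {n : ℕ} (p : ℝ) (Ω : Set (EuclideanSpace ℝ (Fin n)))
    (A : EuclideanSpace ℝ (Fin n) → EuclideanSpace ℝ (Fin n) → EuclideanSpace ℝ (Fin n))
    (νp νm : Measure Ω) (f : EuclideanSpace ℝ (Fin n) → ℝ) : Prop :=
  ∃ G, HasLocSobolevGradient p Ω f G ∧
    ∀ φ : EuclideanSpace ℝ (Fin n) → ℝ, IsTest Ω φ →
      ∫ x in Ω, inner ℝ (A x (G x)) (gradient φ x) = ∫ x : Ω, φ x ∂νp - ∫ x : Ω, φ x ∂νm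

/-- `u ∈ W^{1,p}_{∁Γ}(Ω) ∩ L^∞_{Γ,β}(Ω)` and `u` is `p`-quasicontinuous on `Ω`. The values of `u`
are extended reals; `u` is finite almost everywhere on `Ω` by essential boundedness. -/
structure IsAdmissible {n : ℕ} (p β : ℝ) (Ω Γ : Set (EuclideanSpace ℝ (Fin n)))
    (u : EuclideanSpace ℝ (Fin n) → EReal) : Prop where
  memW1pCompl : MemW1pCompl p Ω Γ (fun x => (u x).toReal)
  memLinftyWeighted : MemLinftyWeighted β Ω Γ u
  quasicontinuous : IsQuasicontinuous p Ω u

end ComparisonPrinciple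

end

/-! Fix ε > 0. The weight bound |u|, |v| ≤ M δ_Γ^β a.e. gives u - v ≤ ε near Γ, so a truncation of u
- v - ε vanishes there and the missing boundary information on Γ does no harm. Away from Γ, u and v
coincide with uφ and vφ for a smooth cutoff φ, and these are W^{1,p}-limits of functions in
C_c^∞(Ω). The class of test functions is never enlarged: the test functions are ηT(f_k - ε), where
f_k in C_c^∞(Ω) approximates h = (u - v)φ, the smooth bounded nondecreasing T =
`Real.smoothTransition` vanishes on (-∞, 0], and η is a second cutoff near Γ. Both inequalities are
tested with the same smooth function, so the terms with ν cancel before any limit is taken.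

With G₁, G₂ the gradients of uφ, vφ, the limit reads ∫ T'(h - ε)(𝒜(x, G₁) - 𝒜(x, G₂))·(G₁ - G₂) ≤ 0.
Strict monotonicity forces T'(h - ε)(G₁ - G₂) = 0 a.e., hence the gradients of ηT(f_k - ε) tend to 0
in L^p. Poincaré's inequality and Fatou's lemma give T(h - ε) = 0 where η = 1, that is, u - v ≤ ε
a.e. (`IsPLaplaceType.ae_le_of_test`, `ae_toReal_sub_le`).

To pass from a.e. to q.e., observe that {u > v} is relatively open in Ω off open sets of small
Sobolev capacity. Since it is null, it has open neighborhoods covered, up to a null set, by those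
small sets (`IsQuasicontinuous.quasieverywhere_notMem`). Mollification, cutoffs along a compact
exhaustion and a sum of test functions turn this into vanishing variational capacity
(`exists_contDiff_one_le_of_hasWeakGradient`, `cap_eq_zero_of_forall_lt`). -/

noncomputable section

namespace ComparisonPrinciple

/-! ### Dominated convergence and Jensen's inequality in L^p. -/

section Lp

variable {α F : Type*} [MeasurableSpace α] {μ : Measure α} [NormedAddCommGroup F]

/-- Dominated convergence to zero in `L^p`. -/
theorem tendsto_eLpNorm_zero_of_dominated {p : ℝ≥0∞} (hp0 : p ≠ 0) (hp : p ≠ ⊤)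
    {f : ℕ → α → F} {g : α → ℝ} (hf : ∀ k, AEStronglyMeasurable (f k) μ) (hg : MemLp g p μ)
    (hbound : ∀ k, ∀ᵐ x ∂μ, ‖f k x‖ ≤ g x)
    (hlim : ∀ᵐ x ∂μ, Tendsto (fun k => f k x) atTop (𝓝 0)) :
    Tendsto (fun k => eLpNorm (f k) p μ) atTop (𝓝 0) := by
  have hpos : 0 < p.toReal := ENNReal.toReal_pos hp0 hp
  have key : Tendsto (fun k => ∫⁻ x, ‖f k x‖ₑ ^ p.toReal ∂μ) atTop (𝓝 (∫⁻ _, 0 ∂μ)) := by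
    refine tendsto_lintegral_of_dominated_convergence' (fun x => ‖g x‖ₑ ^ p.toReal)
      (fun k => (hf k).enorm.pow_const _) (fun k => ?_) ?_ ?_
    · filter_upwards [hbound k] with x hx
      gcongr
      rw [enorm_le_iff_norm_le]
      exact hx.trans (le_abs_self _)
    · exact (lintegral_rpow_enorm_lt_top_of_eLpNorm_lt_top hp0 hp hg.2).ne
    · filter_upwards [hlim] with x hx
      have h1 : Tendsto (fun k => ‖f k x‖ₑ) atTop (𝓝 0) := by
        simpa [Function.comp_def] using (continuous_enorm.tendsto (0 : F)).comp hx
      have h2 := ((ENNReal.continuous_rpow_const (y := p.toReal)).tendsto 0).comp h1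
      simpa [Function.comp_def, ENNReal.zero_rpow_of_pos hpos] using h2
  simp_rw [eLpNorm_eq_lintegral_rpow_enorm_toReal hp0 hp]
  have h2 := ((ENNReal.continuous_rpow_const (y := 1 / p.toReal)).tendsto _).comp key
  simpa [Function.comp_def, ENNReal.zero_rpow_of_pos (inv_pos.2 hpos)] using h2

/-- A power of an average is at most the average of the power. -/
theorem lintegral_rpow_le_of_lintegral_eq_one {p : ℝ} (hp : 1 ≤ p) {ρ g : α → ℝ≥0∞}
    (hρ : AEMeasurable ρ μ) (hg : AEMeasurable g μ) (h1 : ∫⁻ x, ρ x ∂μ = 1) :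
    (∫⁻ x, ρ x * g x ∂μ) ^ p ≤ ∫⁻ x, ρ x * g x ^ p ∂μ := by
  have hprob : IsProbabilityMeasure (μ.withDensity ρ) :=
    ⟨by rw [withDensity_apply _ MeasurableSet.univ, setLIntegral_univ, h1]⟩
  have hgw : AEMeasurable g (μ.withDensity ρ) := hg.mono_ac (withDensity_absolutelyContinuous _ _)
  -- On the probability measure with density ρ, the L^1 norm is at most the L^p norm.
  have key := eLpNorm'_le_eLpNorm'_of_exponent_le (μ := μ.withDensity ρ) (f := g) one_pos hp
    hgw.aestronglyMeasurable
  simp only [eLpNorm', enorm_eq_self, ENNReal.rpow_one, div_one] at key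
  have h2 := ENNReal.rpow_le_rpow key (zero_le_one.trans hp)
  rw [← ENNReal.rpow_mul, one_div, inv_mul_cancel₀ (by positivity), ENNReal.rpow_one] at h2
  rwa [lintegral_withDensity_eq_lintegral_mul₀ hρ hg,
    lintegral_withDensity_eq_lintegral_mul₀ hρ (hg.pow_const p)] at h2

end Lp

/-! ### Young's inequality for averages. -/

section Mollifier

variable {E F : Type*} [NormedAddCommGroup E] [MeasurableSpace E] [BorelSpace E]
  [SecondCountableTopology E] {μ : Measure E} [SFinite μ] [μ.IsAddLeftInvariant] [μ.IsNegInvariant]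
  [NormedAddCommGroup F] [NormedSpace ℝ F]

/-- Convolution with a probability density does not increase the `L^p` norm. -/
theorem lintegral_rpow_average_le {p : ℝ} (hp : 1 ≤ p) {ρ : E → ℝ} (hρ : Measurable ρ)
    (h1 : ∫⁻ x, ‖ρ x‖ₑ ∂μ = 1) {f : E → F} (hf : AEStronglyMeasurable f μ) :
    ∫⁻ x, ‖∫ y, ρ (x - y) • f y ∂μ‖ₑ ^ p ∂μ ≤ ∫⁻ y, ‖f y‖ₑ ^ p ∂μ := by
  have hpt : ∀ x, ‖∫ y, ρ (x - y) • f y ∂μ‖ₑ ^ p ≤ ∫⁻ y, ‖ρ (x - y)‖ₑ * ‖f y‖ₑ ^ p ∂μ := by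
    intro x
    refine le_trans ?_ (lintegral_rpow_le_of_lintegral_eq_one hp
      (hρ.comp (measurable_const.sub measurable_id)).enorm.aemeasurable hf.enorm ?_)
    · gcongr
      refine (enorm_integral_le_lintegral_enorm _).trans_eq ?_
      simp [enorm_smul]
    · rw [← h1]
      exact lintegral_sub_left_eq_self (fun z => ‖ρ z‖ₑ) x
  -- Jensen for the density |ρ(x - ·)|, then Tonelli and translation invariance.
  calc ∫⁻ x, ‖∫ y, ρ (x - y) • f y ∂μ‖ₑ ^ p ∂μ
      ≤ ∫⁻ x, ∫⁻ y, ‖ρ (x - y)‖ₑ * ‖f y‖ₑ ^ p ∂μ ∂μ := lintegral_mono hpt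
    _ = ∫⁻ y, ∫⁻ x, ‖ρ (x - y)‖ₑ * ‖f y‖ₑ ^ p ∂μ ∂μ := by
        refine lintegral_lintegral_swap ?_
        refine ((hρ.comp measurable_sub).enorm.aemeasurable).mul ?_
        exact (hf.enorm.pow_const p).comp_snd
    _ = ∫⁻ y, ‖f y‖ₑ ^ p ∂μ := by
        refine lintegral_congr fun y => ?_
        have hm : Measurable fun x => ‖ρ (x - y)‖ₑ := (hρ.comp (measurable_id.sub_const y)).enorm
        rw [lintegral_mul_const _ hm,
          lintegral_sub_right_eq_self (fun z => ‖ρ z‖ₑ) y, h1, one_mul]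

end Mollifier

/-! ### Mollification of functions with a weak gradient. -/

section WeakGradient

variable {n : ℕ}

theorem gradient_comp_sub_left {ρ : EuclideanSpace ℝ (Fin n) → ℝ} (hρ : Differentiable ℝ ρ)
    (x y : EuclideanSpace ℝ (Fin n)) :
    gradient (fun z => ρ (x - z)) y = - gradient ρ (x - y) := by
  have h1 : HasFDerivAt (fun z => ρ (x - z)) (-(fderiv ℝ ρ (x - y))) y := by
    have h := (hρ (x - y)).hasFDerivAt.comp y ((hasFDerivAt_id y).const_sub x)
    simpa [Function.comp_def] using h
  rw [gradient, h1.fderiv, map_neg, gradient]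

/-- The mollification of a function by a normalized bump function. -/
def mollify (b : ContDiffBump (0 : EuclideanSpace ℝ (Fin n)))
    (w : EuclideanSpace ℝ (Fin n) → ℝ) (x : EuclideanSpace ℝ (Fin n)) : ℝ :=
  ∫ y, b.normed volume (x - y) • w y

theorem mollify_eq_convolution (b : ContDiffBump (0 : EuclideanSpace ℝ (Fin n)))
    (w : EuclideanSpace ℝ (Fin n) → ℝ) :
    mollify b w = convolution w (b.normed volume) (ContinuousLinearMap.lsmul ℝ ℝ) volume := by
  ext x
  simp [mollify, convolution, mul_comm]

theorem lintegral_enorm_normed (b : ContDiffBump (0 : EuclideanSpace ℝ (Fin n))) :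
    ∫⁻ x, ‖b.normed volume x‖ₑ = 1 := by
  have h2 := ofReal_integral_eq_lintegral_ofReal (b.integrable_normed (μ := volume))
    (Eventually.of_forall b.nonneg_normed)
  rw [b.integral_normed, ENNReal.ofReal_one] at h2
  rw [h2]
  exact lintegral_congr fun x => Real.enorm_of_nonneg (b.nonneg_normed x)

theorem contDiff_mollify (b : ContDiffBump (0 : EuclideanSpace ℝ (Fin n)))
    {w : EuclideanSpace ℝ (Fin n) → ℝ} (hw : LocallyIntegrable w volume) :
    ContDiff ℝ ∞ (mollify b w) := by
  rw [mollify_eq_convolution]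
  exact b.hasCompactSupport_normed.contDiff_convolution_right _ hw b.contDiff_normed

theorem contDiff_normed_sub_left (b : ContDiffBump (0 : EuclideanSpace ℝ (Fin n)))
    (x : EuclideanSpace ℝ (Fin n)) : ContDiff ℝ ∞ fun y => b.normed volume (x - y) :=
  b.contDiff_normed.comp (contDiff_const.sub contDiff_id)

theorem hasCompactSupport_normed_sub_left (b : ContDiffBump (0 : EuclideanSpace ℝ (Fin n)))
    (x : EuclideanSpace ℝ (Fin n)) : HasCompactSupport fun y => b.normed volume (x - y) :=
  b.hasCompactSupport_normed.comp_homeomorph (Homeomorph.subLeft x)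

theorem lintegral_mollify_rpow_le {p : ℝ} (hp : 1 ≤ p)
    (b : ContDiffBump (0 : EuclideanSpace ℝ (Fin n))) {w : EuclideanSpace ℝ (Fin n) → ℝ}
    (hw : LocallyIntegrable w volume) :
    ∫⁻ x, ‖mollify b w x‖ₑ ^ p ≤ ∫⁻ x, ‖w x‖ₑ ^ p :=
  lintegral_rpow_average_le hp (b.contDiff_normed (n := 0)).continuous.measurable
    (lintegral_enorm_normed b) hw.aestronglyMeasurable

/-- The derivative falls on the kernel, and the weak gradient is tested with y ↦ ρ(x - y). The
gradient of this function in y is -(∇ρ)(x - y), whose sign cancels the one from integration by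
parts. -/
theorem HasWeakGradient.gradient_mollify {w : EuclideanSpace ℝ (Fin n) → ℝ}
    {G : EuclideanSpace ℝ (Fin n) → EuclideanSpace ℝ (Fin n)} (hw : HasWeakGradient univ w G)
    (b : ContDiffBump (0 : EuclideanSpace ℝ (Fin n))) (x : EuclideanSpace ℝ (Fin n)) :
    gradient (mollify b w) x = ∫ y, b.normed volume (x - y) • G y := by
  obtain ⟨hwl, -, hweak⟩ := hw
  rw [locallyIntegrableOn_univ] at hwl
  set ρ : EuclideanSpace ℝ (Fin n) → ℝ := b.normed volume with hρdef
  have hρc : ContDiff ℝ ∞ ρ := b.contDiff_normed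
  have hρs : HasCompactSupport ρ := b.hasCompactSupport_normed
  have h2 := hweak _
    ⟨contDiff_normed_sub_left b x, hasCompactSupport_normed_sub_left b x, subset_univ _⟩
  simp only [setIntegral_univ, gradient_comp_sub_left (hρc.differentiable (by simp)),
    smul_neg, integral_neg, neg_inj, ← hρdef] at h2
  have h3 : fderiv ℝ (mollify b w) x = ∫ y, w y • fderiv ℝ ρ (x - y) := by
    rw [mollify_eq_convolution, (hρs.hasFDerivAt_convolution_right
      (ContinuousLinearMap.lsmul ℝ ℝ) hwl (hρc.of_le (by simp)) x).fderiv, convolution]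
    refine integral_congr_ae (Eventually.of_forall fun y => ?_)
    ext z
    simp
  have h5 : Integrable fun y => w y • fderiv ℝ ρ (x - y) :=
    hwl.integrable_smul_right_of_hasCompactSupport
      ((hρc.continuous_fderiv (by simp)).comp (continuous_const.sub continuous_id))
      ((hρs.fderiv ℝ).comp_homeomorph (Homeomorph.subLeft x))
  have h4 := ContinuousLinearMap.integral_comp_commSL (by simp)
    (InnerProductSpace.toDual ℝ
      (EuclideanSpace ℝ (Fin n))).symm.toContinuousLinearEquiv.toContinuousLinearMap h5
  simp only [ContinuousLinearEquiv.coe_coe,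
    LinearIsometryEquiv.coe_toContinuousLinearEquiv] at h4
  rw [← h2, gradient, h3, ← h4]
  simp [gradient]

theorem HasWeakGradient.lintegral_gradient_mollify_rpow_le {p : ℝ} (hp : 1 ≤ p)
    {w : EuclideanSpace ℝ (Fin n) → ℝ} {G : EuclideanSpace ℝ (Fin n) → EuclideanSpace ℝ (Fin n)}
    (hw : HasWeakGradient univ w G) (b : ContDiffBump (0 : EuclideanSpace ℝ (Fin n))) :
    ∫⁻ x, ‖gradient (mollify b w) x‖ₑ ^ p ≤ ∫⁻ x, ‖G x‖ₑ ^ p := by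
  have hG := hw.2.1
  rw [locallyIntegrableOn_univ] at hG
  simp_rw [hw.gradient_mollify b]
  exact lintegral_rpow_average_le hp (b.contDiff_normed (n := 0)).continuous.measurable
    (lintegral_enorm_normed b) hG.aestronglyMeasurable

/-- One sequence of kernels serves all w, so that two functions can be mollified with a common
index. The ratio 2 of the radii is kept fixed, as differentiation at Lebesgue points requires. -/
theorem ae_tendsto_mollify :
    ∃ b : ℕ → ContDiffBump (0 : EuclideanSpace ℝ (Fin n)),
      ∀ w : EuclideanSpace ℝ (Fin n) → ℝ, LocallyIntegrable w volume →
        ∀ᵐ x, Tendsto (fun k => mollify (b k) w x) atTop (𝓝 (w x)) := by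
  have hpos : ∀ k : ℕ, (0 : ℝ) < 1 / ((k : ℝ) + 1) := fun k => by positivity
  refine ⟨fun k => ⟨1 / ((k : ℝ) + 1), 2 * (1 / ((k : ℝ) + 1)), hpos k, ?_⟩, fun w hw => ?_⟩
  · linarith [hpos k]
  have h := ContDiffBump.ae_convolution_tendsto_right_of_locallyIntegrable
    (φ := fun k : ℕ => (⟨1 / ((k : ℝ) + 1), 2 * (1 / ((k : ℝ) + 1)), hpos k, by
      linarith [hpos k]⟩ : ContDiffBump (0 : EuclideanSpace ℝ (Fin n)))) (l := atTop) (K := 2)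
    (μ := volume) (g := w) ?_ (Eventually.of_forall fun k => le_rfl) hw
  · filter_upwards [h] with x hx
    refine hx.congr fun k => ?_
    rw [convolution_lsmul_swap]
    rfl
  · simpa using (tendsto_one_div_add_atTop_nhds_zero_nat (𝕜 := ℝ)).const_mul 2

/-- The classical gradient of a smooth function is a weak gradient. -/
theorem hasWeakGradient_gradient {g : EuclideanSpace ℝ (Fin n) → ℝ} (hg : ContDiff ℝ ∞ g) :
    HasWeakGradient univ g (gradient g) := by
  have hgc : Continuous (gradient g) :=
    (LinearIsometryEquiv.continuous _).comp (hg.continuous_fderiv (by simp))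
  refine ⟨hg.continuous.locallyIntegrable.locallyIntegrableOn _,
    hgc.locallyIntegrable.locallyIntegrableOn _, fun φ ⟨hφ, hφs, _⟩ => ?_⟩
  have hφc : Continuous (gradient φ) :=
    (LinearIsometryEquiv.continuous _).comp (hφ.continuous_fderiv (by simp))
  have hφgs : HasCompactSupport (gradient φ) :=
    HasCompactSupport.intro hφs fun x hx => by
      simp [gradient, fderiv_of_notMem_tsupport (𝕜 := ℝ) hx]
  have i1 : Integrable fun x => g x • gradient φ x :=
    (hg.continuous.smul hφc).integrable_of_hasCompactSupport hφgs.smul_left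
  have i2 : Integrable fun x => φ x • gradient g x :=
    (hφ.continuous.smul hgc).integrable_of_hasCompactSupport hφs.smul_right
  rw [setIntegral_univ, setIntegral_univ]
  -- Pairing with a fixed direction e reduces the vector identity to integration by parts for
  -- directional derivatives.
  refine ext_inner_left ℝ fun e => ?_
  rw [inner_neg_right, ← integral_inner i1 e, ← integral_inner i2 e]
  have hin : ∀ (f : EuclideanSpace ℝ (Fin n) → ℝ) x, inner ℝ e (gradient f x) = fderiv ℝ f x e :=
    fun f x => by rw [real_inner_comm, gradient, InnerProductSpace.toDual_symm_apply]
  simp only [inner_smul_right, hin]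
  have hfe : ∀ {f : EuclideanSpace ℝ (Fin n) → ℝ}, ContDiff ℝ ∞ f →
      Continuous fun x => fderiv ℝ f x e := fun hf =>
    (hf.continuous_fderiv (by simp)).clm_apply continuous_const
  have hφes : HasCompactSupport fun x => fderiv ℝ φ x e :=
    HasCompactSupport.intro hφs fun x hx => by
      simp [fderiv_of_notMem_tsupport (𝕜 := ℝ) hx]
  rw [integral_mul_fderiv_eq_neg_fderiv_mul_of_integrable]
  · simp only [mul_comm]
  · exact ((hfe hg).mul hφ.continuous).integrable_of_hasCompactSupport hφs.mul_left
  · exact (hg.continuous.mul (hfe hφ)).integrable_of_hasCompactSupport hφes.mul_left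
  · exact (hg.continuous.mul hφ.continuous).integrable_of_hasCompactSupport hφs.mul_left
  · exact fun x _ => hg.differentiable (by simp) x
  · exact fun x _ => hφ.differentiable (by simp) x

end WeakGradient

/-! ### Calculus rules for the gradient. -/

section Gradient

variable {n : ℕ}

theorem gradient_fun_mul {f g : EuclideanSpace ℝ (Fin n) → ℝ} {x : EuclideanSpace ℝ (Fin n)}
    (hf : DifferentiableAt ℝ f x) (hg : DifferentiableAt ℝ g x) :
    gradient (fun y => f y * g y) x = f x • gradient g x + g x • gradient f x := by
  simp [gradient, fderiv_fun_mul hf hg]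

theorem gradient_fun_sub {f g : EuclideanSpace ℝ (Fin n) → ℝ} {x : EuclideanSpace ℝ (Fin n)}
    (hf : DifferentiableAt ℝ f x) (hg : DifferentiableAt ℝ g x) :
    gradient (fun y => f y - g y) x = gradient f x - gradient g x := by
  simp [gradient, fderiv_fun_sub hf hg]

theorem gradient_fun_sum {ι : Type*} (s : Finset ι) {f : ι → EuclideanSpace ℝ (Fin n) → ℝ}
    {x : EuclideanSpace ℝ (Fin n)} (hf : ∀ i ∈ s, DifferentiableAt ℝ (f i) x) :
    gradient (fun y => ∑ i ∈ s, f i y) x = ∑ i ∈ s, gradient (f i) x := by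
  simp [gradient, fderiv_fun_sum hf]

theorem gradient_fun_comp {T : ℝ → ℝ} {g : EuclideanSpace ℝ (Fin n) → ℝ}
    {x : EuclideanSpace ℝ (Fin n)} (hT : DifferentiableAt ℝ T (g x))
    (hg : DifferentiableAt ℝ g x) :
    gradient (fun y => T (g y)) x = deriv T (g x) • gradient g x := by
  have h : HasFDerivAt (fun y => T (g y)) (deriv T (g x) • fderiv ℝ g x) x :=
    hT.hasDerivAt.comp_hasFDerivAt x hg.hasFDerivAt
  rw [gradient, h.fderiv]
  simp [gradient]

theorem continuous_gradient {f : EuclideanSpace ℝ (Fin n) → ℝ} (hf : ContDiff ℝ ∞ f) :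
    Continuous (gradient f) :=
  (LinearIsometryEquiv.continuous _).comp (hf.continuous_fderiv (by simp))

theorem gradient_eq_zero_of_notMem_tsupport {f : EuclideanSpace ℝ (Fin n) → ℝ}
    {x : EuclideanSpace ℝ (Fin n)} (hx : x ∉ tsupport f) : gradient f x = 0 := by
  simp [gradient, fderiv_of_notMem_tsupport (𝕜 := ℝ) hx]

end Gradient

/-! ### The smooth truncation. -/

section SmoothTransition

/-- The transition function is constant on each side of [0, 1], so its continuous derivative has
compact support. -/
theorem exists_norm_deriv_smoothTransition_le :
    ∃ C : ℝ, 0 < C ∧ ∀ t, |deriv Real.smoothTransition t| ≤ C := by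
  have hs : HasCompactSupport (deriv Real.smoothTransition) := by
    refine HasCompactSupport.intro (isCompact_Icc (a := (0 : ℝ)) (b := 1)) fun t ht => ?_
    rw [mem_Icc, not_and_or, not_le, not_le] at ht
    rcases ht with ht | ht
    · have : Real.smoothTransition =ᶠ[𝓝 t] fun _ => 0 := by
        filter_upwards [Iio_mem_nhds ht] with s hs
        exact Real.smoothTransition.zero_of_nonpos (le_of_lt hs)
      simp [this.deriv_eq]
    · have : Real.smoothTransition =ᶠ[𝓝 t] fun _ => 1 := by
        filter_upwards [Ioi_mem_nhds ht] with s hs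
        exact Real.smoothTransition.one_of_one_le (le_of_lt hs)
      simp [this.deriv_eq]
  have hc : Continuous (deriv Real.smoothTransition) :=
    (Real.smoothTransition.contDiff (n := 1)).continuous_deriv (by simp)
  obtain ⟨C, hC⟩ := hs.exists_bound_of_continuous hc
  exact ⟨max C 1, by positivity, fun t => (hC t).trans (le_max_left _ _)⟩

theorem abs_smoothTransition_sub_le {C : ℝ} (hC : ∀ t, |deriv Real.smoothTransition t| ≤ C)
    (s t : ℝ) : |Real.smoothTransition t - Real.smoothTransition s| ≤ C * |t - s| :=
  Convex.norm_image_sub_le_of_norm_deriv_le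
    (fun x _ => (Real.smoothTransition.contDiff (n := 1)).differentiable (by simp) x)
    (fun x _ => hC x) convex_univ (mem_univ s) (mem_univ t)

end SmoothTransition

/-! ### From almost everywhere to quasieverywhere. -/

section Capacity

variable {n : ℕ}

theorem exists_contDiff_zero_one {s t : Set (EuclideanSpace ℝ (Fin n))} (hs : IsClosed s)
    (ht : IsClosed t) (hd : Disjoint s t) :
    ∃ f : EuclideanSpace ℝ (Fin n) → ℝ, ContDiff ℝ ∞ f ∧ (∀ x ∈ s, f x = 0) ∧
      (∀ x ∈ t, f x = 1) ∧ (∀ x, 0 ≤ f x) ∧ ∀ x, f x ≤ 1 := by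
  obtain ⟨f, h0, h1, h2⟩ := exists_contMDiffMap_zero_one_of_isClosed
    (modelWithCornersSelf ℝ (EuclideanSpace ℝ (Fin n))) hs ht hd (n := ⊤)
  exact ⟨f, f.contMDiff.contDiff, h0, h1, fun x => (h2 x).1, fun x => (h2 x).2⟩

theorem exists_isTest_eq_one {K Ω : Set (EuclideanSpace ℝ (Fin n))} (hK : IsCompact K)
    (hΩ : IsOpen Ω) (hKΩ : K ⊆ Ω) :
    ∃ η : EuclideanSpace ℝ (Fin n) → ℝ, IsTest Ω η ∧ (∀ x, 0 ≤ η x) ∧ ∀ x ∈ K, η x = 1 := by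
  obtain ⟨L, hL, hKL, hLΩ⟩ := exists_compact_between hK hΩ hKΩ
  obtain ⟨η, hη, h0, h1, h2, -⟩ := exists_contDiff_zero_one (s := (interior L)ᶜ) (t := K)
    isOpen_interior.isClosed_compl hK.isClosed
    (disjoint_left.2 fun x hx hx' => hx (hKL hx'))
  have hs : tsupport η ⊆ L := by
    refine closure_minimal (fun x hx => ?_) hL.isClosed
    by_contra hxL
    exact hx (h0 x fun h => hxL (interior_subset h))
  exact ⟨η, ⟨hη, hL.of_isClosed_subset (isClosed_tsupport _) hs, hs.trans hLΩ⟩, h2, h1⟩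

/-- If one of two Sobolev functions is at least `1` almost everywhere near a compact set, then
there is a smooth nonnegative function of comparable Sobolev norm which is at least `1` on that
set. -/
theorem exists_contDiff_one_le_of_hasWeakGradient {p : ℝ} (hp : 1 ≤ p) :
    ∃ C : ℝ≥0∞, C ≠ ⊤ ∧ ∀ (w₁ w₂ : EuclideanSpace ℝ (Fin n) → ℝ)
      (G₁ G₂ : EuclideanSpace ℝ (Fin n) → EuclideanSpace ℝ (Fin n))
      (U K : Set (EuclideanSpace ℝ (Fin n))), HasWeakGradient univ w₁ G₁ →
      HasWeakGradient univ w₂ G₂ → IsOpen U →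
      (∀ᵐ x ∂(volume.restrict U), 1 ≤ w₁ x ∨ 1 ≤ w₂ x) → IsCompact K → K ⊆ U →
      ∃ g : EuclideanSpace ℝ (Fin n) → ℝ, ContDiff ℝ ∞ g ∧ (∀ x, 0 ≤ g x) ∧ (∀ x ∈ K, 1 ≤ g x) ∧
        ∫⁻ x, ‖g x‖ₑ ^ p ≤ C * ((∫⁻ x, ‖w₁ x‖ₑ ^ p) + ∫⁻ x, ‖w₂ x‖ₑ ^ p) ∧
        ∫⁻ x, ‖gradient g x‖ₑ ^ p ≤ C * ((∫⁻ x, ‖G₁ x‖ₑ ^ p) + ∫⁻ x, ‖G₂ x‖ₑ ^ p) := by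
  obtain ⟨D, hD0, hD⟩ := exists_norm_deriv_smoothTransition_le
  -- 2D is a Lipschitz constant of t ↦ 2T(t), and 2^(p-1) comes from (a + b)^p ≤ 2^(p-1)(a^p + b^p).
  refine ⟨ENNReal.ofReal (2 * D) ^ p * 2 ^ (p - 1), ENNReal.mul_ne_top
    (ENNReal.rpow_ne_top_of_nonneg (by positivity) ENNReal.ofReal_ne_top)
    (ENNReal.rpow_ne_top_of_nonneg (by linarith) (by simp)), ?_⟩
  intro w₁ w₂ G₁ G₂ U K hw₁ hw₂ hU hwU hK hKU
  have hl₁ := hw₁.1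
  have hl₂ := hw₂.1
  rw [locallyIntegrableOn_univ] at hl₁ hl₂
  obtain ⟨b, hb⟩ := ae_tendsto_mollify (n := n)
  have hT : ContDiff ℝ ∞ Real.smoothTransition := Real.smoothTransition.contDiff
  let T := Real.smoothTransition
  -- A smooth substitute for the maximum of w₁ and w₂. Since T ≥ 0 and T = 1 on [1, ∞), the limit of
  -- f k is at least 2 a.e. on U. The factor 2 leaves a margin of 1 for the second mollification
  -- below.
  let f : ℕ → EuclideanSpace ℝ (Fin n) → ℝ :=
    fun k x => 2 * (T (mollify (b k) w₁ x) + T (mollify (b k) w₂ x))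
  have hm₁ : ∀ k, ContDiff ℝ ∞ (mollify (b k) w₁) := fun k => contDiff_mollify _ hl₁
  have hm₂ : ∀ k, ContDiff ℝ ∞ (mollify (b k) w₂) := fun k => contDiff_mollify _ hl₂
  have hTm₁ : ∀ k, ContDiff ℝ ∞ fun x => T (mollify (b k) w₁ x) := fun k => hT.comp (hm₁ k)
  have hTm₂ : ∀ k, ContDiff ℝ ∞ fun x => T (mollify (b k) w₂ x) := fun k => hT.comp (hm₂ k)
  have hf : ∀ k, ContDiff ℝ ∞ (f k) := fun k => contDiff_const.mul ((hTm₁ k).add (hTm₂ k))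
  have hf0 : ∀ k x, 0 ≤ f k x := fun k x =>
    mul_nonneg zero_le_two (add_nonneg (Real.smoothTransition.nonneg _)
      (Real.smoothTransition.nonneg _))
  have hTle : ∀ t, |T t| ≤ D * |t| := fun t => by
    simpa [T] using abs_smoothTransition_sub_le hD 0 t
  have hfle : ∀ k x, ‖f k x‖ ≤ 2 * D * (‖mollify (b k) w₁ x‖ + ‖mollify (b k) w₂ x‖) := by
    intro k x
    have h1 := hTle (mollify (b k) w₁ x)
    have h2 := hTle (mollify (b k) w₂ x)
    have h3 := abs_add_le (T (mollify (b k) w₁ x)) (T (mollify (b k) w₂ x))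
    simp only [f, norm_mul, Real.norm_eq_abs, Nat.abs_ofNat]
    linarith
  have hgf : ∀ k x, gradient (f k) x =
      (2 : ℝ) • (deriv T (mollify (b k) w₁ x) • gradient (mollify (b k) w₁) x +
        deriv T (mollify (b k) w₂ x) • gradient (mollify (b k) w₂) x) := by
    intro k x
    have hd₁ := (hTm₁ k).differentiable (by simp) x
    have hd₂ := (hTm₂ k).differentiable (by simp) x
    have h : gradient (f k) x = (2 : ℝ) • (gradient (fun x => T (mollify (b k) w₁ x)) x +
        gradient (fun x => T (mollify (b k) w₂ x)) x) := by
      simp only [gradient, f, fderiv_const_mul (hd₁.fun_add hd₂), fderiv_fun_add hd₁ hd₂]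
      simp
    rw [h, gradient_fun_comp (hT.differentiable (by simp) _) ((hm₁ k).differentiable (by simp) x),
      gradient_fun_comp (hT.differentiable (by simp) _) ((hm₂ k).differentiable (by simp) x)]
  have hgfle : ∀ k x, ‖gradient (f k) x‖ ≤
      2 * D * (‖gradient (mollify (b k) w₁) x‖ + ‖gradient (mollify (b k) w₂) x‖) := by
    intro k x
    have h1 : ‖deriv T (mollify (b k) w₁ x) • gradient (mollify (b k) w₁) x‖ ≤
        D * ‖gradient (mollify (b k) w₁) x‖ := by
      rw [norm_smul]
      exact mul_le_mul_of_nonneg_right (hD _) (norm_nonneg _)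
    have h2 : ‖deriv T (mollify (b k) w₂ x) • gradient (mollify (b k) w₂) x‖ ≤
        D * ‖gradient (mollify (b k) w₂) x‖ := by
      rw [norm_smul]
      exact mul_le_mul_of_nonneg_right (hD _) (norm_nonneg _)
    have h3 := norm_add_le (deriv T (mollify (b k) w₁ x) • gradient (mollify (b k) w₁) x)
      (deriv T (mollify (b k) w₂ x) • gradient (mollify (b k) w₂) x)
    rw [hgf, norm_smul, Real.norm_ofNat]
    linarith
  have hgc : ∀ k (w : EuclideanSpace ℝ (Fin n) → ℝ), ContDiff ℝ ∞ (mollify (b k) w) →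
      Continuous (gradient (mollify (b k) w)) := fun k w h => continuous_gradient h
  obtain ⟨δ, hδ, hδU⟩ := hK.exists_cthickening_subset_open hU hKU
  set B := Metric.cthickening δ K with hB
  have hBc : IsCompact B := hK.cthickening
  have hBm : MeasurableSet B := hBc.isClosed.measurableSet
  have hBfin : IsFiniteMeasure (volume.restrict B) := ⟨by simpa using hBc.measure_lt_top⟩
  -- The second mollification has a fixed scale δ, independent of k. It turns L^1 smallness on B of
  -- the defect d k = (2 - f k)₊ into a uniform bound on K: for x in K the kernel ρ(x - ·) lives in
  -- B and is at most R, so the mollified value is at least 2 - R ∫_B d k.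
  let β : ContDiffBump (0 : EuclideanSpace ℝ (Fin n)) := ⟨δ / 2, δ, by positivity, by linarith⟩
  set ρ : EuclideanSpace ℝ (Fin n) → ℝ := β.normed volume with hρdef
  have hρ0 : ∀ x, 0 ≤ ρ x := β.nonneg_normed
  obtain ⟨R, hR⟩ := (β.hasCompactSupport_normed (μ := volume)).exists_bound_of_continuous
    (β.contDiff_normed (n := 0)).continuous
  have hR0 : 0 ≤ R := (norm_nonneg _).trans (hR 0)
  let d : ℕ → EuclideanSpace ℝ (Fin n) → ℝ := fun k x => max 0 (2 - f k x)
  have hdc : ∀ k, Continuous (d k) := fun k =>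
    continuous_const.max (continuous_const.sub (hf k).continuous)
  have hd0 : ∀ k x, 0 ≤ d k x := fun k x => le_max_left _ _
  have hd2 : ∀ k x, d k x ≤ 2 := fun k x => max_le zero_le_two (by linarith [hf0 k x])
  have hdlim : Tendsto (fun k => ∫ x in B, d k x) atTop (𝓝 (∫ _ in B, (0 : ℝ))) := by
    refine tendsto_integral_of_dominated_convergence (fun _ => 2)
      (fun k => (hdc k).aestronglyMeasurable) (integrable_const 2)
      (fun k => Eventually.of_forall fun x => ?_) ?_
    · rw [Real.norm_of_nonneg (hd0 k x)]
      exact hd2 k x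
    · filter_upwards [ae_mono (Measure.restrict_mono hδU le_rfl) hwU,
        ae_restrict_of_ae (hb w₁ hl₁), ae_restrict_of_ae (hb w₂ hl₂)] with x hx h1 h2
      have h3 : Tendsto (fun k => d k x) atTop (𝓝 (max 0 (2 - 2 * (T (w₁ x) + T (w₂ x))))) := by
        refine tendsto_const_nhds.max (tendsto_const_nhds.sub (tendsto_const_nhds.mul ?_))
        exact ((hT.continuous.tendsto _).comp h1).add ((hT.continuous.tendsto _).comp h2)
      have h4 : 1 ≤ T (w₁ x) + T (w₂ x) := by
        rcases hx with hx | hx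
        · have := Real.smoothTransition.one_of_one_le hx
          linarith [Real.smoothTransition.nonneg (w₂ x)]
        · have := Real.smoothTransition.one_of_one_le hx
          linarith [Real.smoothTransition.nonneg (w₁ x)]
      rwa [max_eq_left (by linarith)] at h3
  rw [integral_zero] at hdlim
  obtain ⟨k, hk⟩ := ((hdlim.const_mul R).eventually
    (gt_mem_nhds (show R * 0 < 1 by simp))).exists
  have hfl : LocallyIntegrable (f k) volume := (hf k).continuous.locallyIntegrable
  have hsum : ∀ {f g₁ g₂ : EuclideanSpace ℝ (Fin n) → ℝ≥0∞}, (∀ x, f x ≤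
      ENNReal.ofReal (2 * D) * (g₁ x + g₂ x)) → Measurable g₁ →
      ∫⁻ x, f x ^ p ≤ ENNReal.ofReal (2 * D) ^ p * 2 ^ (p - 1) *
        ((∫⁻ x, g₁ x ^ p) + ∫⁻ x, g₂ x ^ p) := by
    intro f g₁ g₂ h hg₁
    rw [← lintegral_add_left (hg₁.pow_const p), ← lintegral_const_mul' _ _ (ENNReal.mul_ne_top
      (ENNReal.rpow_ne_top_of_nonneg (by positivity) ENNReal.ofReal_ne_top)
      (ENNReal.rpow_ne_top_of_nonneg (by linarith) (by simp)))]
    refine lintegral_mono fun x => ?_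
    calc f x ^ p ≤ (ENNReal.ofReal (2 * D) * (g₁ x + g₂ x)) ^ p := by gcongr; exact h x
      _ ≤ _ := by
        rw [ENNReal.mul_rpow_of_nonneg _ _ (by positivity), mul_assoc]
        gcongr
        exact ENNReal.rpow_add_le_mul_rpow_add_rpow _ _ hp
  have hen : ∀ {M a b c : ℝ}, 0 ≤ b → 0 ≤ c → a ≤ M * (b + c) →
      ENNReal.ofReal a ≤ ENNReal.ofReal M * (ENNReal.ofReal b + ENNReal.ofReal c) := by
    intro M a b c hb hc h
    rw [← ENNReal.ofReal_add hb hc, ← ENNReal.ofReal_mul' (by positivity)]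
    exact ENNReal.ofReal_le_ofReal h
  refine ⟨mollify β (f k), contDiff_mollify β hfl, fun x => ?_, fun x hx => ?_, ?_, ?_⟩
  · exact integral_nonneg fun y => mul_nonneg (hρ0 _) (hf0 k y)
  · have hint : ∀ {h : EuclideanSpace ℝ (Fin n) → ℝ}, Continuous h →
        Integrable (fun y => ρ (x - y) • h y) := fun hh =>
      hh.locallyIntegrable.integrable_smul_left_of_hasCompactSupport
        (contDiff_normed_sub_left β x).continuous (hasCompactSupport_normed_sub_left β x)
    have h1 : ∫ y, ρ (x - y) • (2 : ℝ) = 2 := by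
      simp only [smul_eq_mul]
      rw [integral_mul_const, integral_sub_left_eq_self ρ volume x, hρdef, β.integral_normed,
        one_mul]
    have h2 : ∫ y, ρ (x - y) • d k y ≤ R * ∫ y in B, d k y := by
      rw [← integral_const_mul, ← integral_indicator hBm]
      refine integral_mono (hint (hdc k)) (IntegrableOn.integrable_indicator
        (((hdc k).continuousOn.integrableOn_compact hBc).const_mul R) hBm) fun y => ?_
      by_cases hy : y ∈ B
      · rw [indicator_of_mem hy]
        exact mul_le_mul_of_nonneg_right ((le_abs_self _).trans (hR _)) (hd0 k y)
      · rw [indicator_of_notMem hy]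
        have : ρ (x - y) = 0 := by
          rw [← Function.notMem_support, hρdef, β.support_normed_eq]
          intro hmem
          refine hy (Metric.mem_cthickening_of_dist_le y x δ K hx ?_)
          have h3 : ‖x - y‖ < δ := by simpa using hmem
          rw [dist_comm, dist_eq_norm]
          exact h3.le
        simp [this]
    have h3 : ∫ y, ρ (x - y) • (2 : ℝ) ≤ ∫ y, (ρ (x - y) • f k y + ρ (x - y) • d k y) := by
      refine integral_mono (hint continuous_const)
        ((hint (hf k).continuous).add (hint (hdc k))) fun y => ?_
      have h4 : 2 - f k y ≤ d k y := le_max_right _ _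
      have := mul_le_mul_of_nonneg_left h4 (hρ0 (x - y))
      simp only [smul_eq_mul]
      linarith
    rw [h1, integral_add (hint (hf k).continuous) (hint (hdc k))] at h3
    have h5 : mollify β (f k) x = ∫ y, ρ (x - y) • f k y := rfl
    linarith
  · refine (lintegral_mollify_rpow_le hp β hfl).trans ((hsum (g₁ := fun x =>
      ‖mollify (b k) w₁ x‖ₑ) (g₂ := fun x => ‖mollify (b k) w₂ x‖ₑ) (fun x => ?_)
      (hm₁ k).continuous.measurable.enorm).trans ?_)
    · simpa only [ofReal_norm] using hen (norm_nonneg _) (norm_nonneg _) (hfle k x)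
    · exact mul_le_mul_right (add_le_add (lintegral_mollify_rpow_le hp _ hl₁)
        (lintegral_mollify_rpow_le hp _ hl₂)) _
  · refine ((hasWeakGradient_gradient (hf k)).lintegral_gradient_mollify_rpow_le hp β).trans
      ((hsum (g₁ := fun x => ‖gradient (mollify (b k) w₁) x‖ₑ)
        (g₂ := fun x => ‖gradient (mollify (b k) w₂) x‖ₑ) (fun x => ?_)
        (hgc k _ (hm₁ k)).measurable.enorm).trans ?_)
    · simpa only [ofReal_norm] using hen (norm_nonneg _) (norm_nonneg _) (hgfle k x)
    · exact mul_le_mul_right (add_le_add (hw₁.lintegral_gradient_mollify_rpow_le hp _)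
        (hw₂.lintegral_gradient_mollify_rpow_le hp _)) _

/-- The `L^p` norm of the gradient of a smooth function, cut off by a fixed test function, is
controlled by its Sobolev norm. -/
theorem IsTest.exists_lintegral_gradient_mul_le {p : ℝ} (hp : 1 ≤ p)
    {Ω : Set (EuclideanSpace ℝ (Fin n))} {η : EuclideanSpace ℝ (Fin n) → ℝ} (hη : IsTest Ω η) :
    ∃ C : ℝ≥0∞, C ≠ ⊤ ∧ ∀ g : EuclideanSpace ℝ (Fin n) → ℝ, ContDiff ℝ ∞ g →
      ∫⁻ x, ‖gradient (fun y => η y * g y) x‖ₑ ^ p ≤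
        C * ((∫⁻ x, ‖g x‖ₑ ^ p) + ∫⁻ x, ‖gradient g x‖ₑ ^ p) := by
  obtain ⟨hηc, hηs, hηΩ⟩ := hη
  obtain ⟨C₁, hC₁⟩ := hηs.exists_bound_of_continuous hηc.continuous
  have hgs : HasCompactSupport (gradient η) :=
    HasCompactSupport.intro hηs fun x hx => gradient_eq_zero_of_notMem_tsupport hx
  obtain ⟨C₂, hC₂⟩ := hgs.exists_bound_of_continuous (continuous_gradient hηc)
  set M : ℝ := max C₁ C₂ with hM
  have hC : ENNReal.ofReal M ^ p * 2 ^ (p - 1) ≠ ⊤ := ENNReal.mul_ne_top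
    (ENNReal.rpow_ne_top_of_nonneg (by positivity) ENNReal.ofReal_ne_top)
    (ENNReal.rpow_ne_top_of_nonneg (by linarith) (by simp))
  refine ⟨ENNReal.ofReal M ^ p * 2 ^ (p - 1), hC, fun g hg => ?_⟩
  have hgm : Measurable fun x => ‖g x‖ₑ ^ p := hg.continuous.measurable.enorm.pow_const p
  rw [← lintegral_add_left hgm, ← lintegral_const_mul' _ _ hC]
  refine lintegral_mono fun x => ?_
  have h1 : ‖gradient (fun y => η y * g y) x‖ ≤ M * (‖g x‖ + ‖gradient g x‖) := by
    rw [gradient_fun_mul (hηc.differentiable (by simp) x) (hg.differentiable (by simp) x)]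
    have h3 : ‖η x‖ ≤ M := (hC₁ x).trans (le_max_left _ _)
    have h4 : ‖gradient η x‖ ≤ M := (hC₂ x).trans (le_max_right _ _)
    refine (norm_add_le _ _).trans ?_
    rw [norm_smul, norm_smul]
    calc ‖η x‖ * ‖gradient g x‖ + ‖g x‖ * ‖gradient η x‖
        ≤ M * ‖gradient g x‖ + ‖g x‖ * M := by gcongr
      _ = M * (‖g x‖ + ‖gradient g x‖) := by ring
  have h2 : ‖gradient (fun y => η y * g y) x‖ₑ ≤
      ENNReal.ofReal M * (‖g x‖ₑ + ‖gradient g x‖ₑ) := by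
    rw [← ofReal_norm, ← ofReal_norm, ← ofReal_norm,
      ← ENNReal.ofReal_add (norm_nonneg _) (norm_nonneg _),
      ← ENNReal.ofReal_mul' (by positivity)]
    exact ENNReal.ofReal_le_ofReal h1
  calc _ ≤ (ENNReal.ofReal M * (‖g x‖ₑ + ‖gradient g x‖ₑ)) ^ p := by gcongr
    _ ≤ _ := by
      rw [ENNReal.mul_rpow_of_nonneg _ _ (by positivity), mul_assoc]
      gcongr
      exact ENNReal.rpow_add_le_mul_rpow_add_rpow _ _ hp

/-- A pair of Sobolev functions one of which is at least `1` near a compact set can be turned into a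
test function, at the price of a constant that depends only on the cutoff function. -/
theorem exists_isTest_of_hasWeakGradient {p : ℝ} (hp : 1 ≤ p)
    {Ω : Set (EuclideanSpace ℝ (Fin n))} {η : EuclideanSpace ℝ (Fin n) → ℝ} (hη : IsTest Ω η)
    (hη0 : ∀ x, 0 ≤ η x) :
    ∃ C : ℝ≥0∞, C ≠ ⊤ ∧ ∀ (w₁ w₂ : EuclideanSpace ℝ (Fin n) → ℝ)
      (G₁ G₂ : EuclideanSpace ℝ (Fin n) → EuclideanSpace ℝ (Fin n))
      (U K : Set (EuclideanSpace ℝ (Fin n))), HasWeakGradient univ w₁ G₁ →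
      HasWeakGradient univ w₂ G₂ → IsOpen U →
      (∀ᵐ x ∂(volume.restrict U), 1 ≤ w₁ x ∨ 1 ≤ w₂ x) → IsCompact K → K ⊆ U →
      (∀ x ∈ K, η x = 1) →
      ∃ ψ : EuclideanSpace ℝ (Fin n) → ℝ, IsTest Ω ψ ∧ (∀ x, 0 ≤ ψ x) ∧ (∀ x ∈ K, 1 ≤ ψ x) ∧
        ∫⁻ x, ‖gradient ψ x‖ₑ ^ p ≤ C * ((∫⁻ x, (‖w₁ x‖ₑ ^ p + ‖G₁ x‖ₑ ^ p)) +
          ∫⁻ x, (‖w₂ x‖ₑ ^ p + ‖G₂ x‖ₑ ^ p)) := by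
  obtain ⟨C₁, hC₁, h1⟩ := exists_contDiff_one_le_of_hasWeakGradient (n := n) hp
  obtain ⟨C₂, hC₂, h2⟩ := hη.exists_lintegral_gradient_mul_le hp
  refine ⟨C₂ * C₁, ENNReal.mul_ne_top hC₂ hC₁, ?_⟩
  intro w₁ w₂ G₁ G₂ U K hw₁ hw₂ hU hwU hK hKU hηK
  obtain ⟨g, hg, hg0, hg1, hgw, hgG⟩ := h1 w₁ w₂ G₁ G₂ U K hw₁ hw₂ hU hwU hK hKU
  refine ⟨fun x => η x * g x, ⟨hη.1.mul hg, hη.2.1.mul_right,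
    tsupport_mul_subset_left.trans hη.2.2⟩, fun x => mul_nonneg (hη0 x) (hg0 x),
    fun x hx => by simpa [hηK x hx] using hg1 x hx, (h2 g hg).trans ?_⟩
  have hm : ∀ {w : EuclideanSpace ℝ (Fin n) → ℝ}
      {G : EuclideanSpace ℝ (Fin n) → EuclideanSpace ℝ (Fin n)}, HasWeakGradient univ w G →
      AEMeasurable (fun x => ‖w x‖ₑ ^ p) volume := fun hw => by
    have := hw.1
    rw [locallyIntegrableOn_univ] at this
    exact this.aestronglyMeasurable.enorm.pow_const p
  rw [lintegral_add_left' (hm hw₁), lintegral_add_left' (hm hw₂), mul_assoc]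
  gcongr
  calc _ ≤ C₁ * ((∫⁻ x, ‖w₁ x‖ₑ ^ p) + ∫⁻ x, ‖w₂ x‖ₑ ^ p) +
        C₁ * ((∫⁻ x, ‖G₁ x‖ₑ ^ p) + ∫⁻ x, ‖G₂ x‖ₑ ^ p) := add_le_add hgw hgG
    _ = _ := by ring

/-- A subset of `Ω` is of capacity zero relative to `Ω` if it has neighborhoods on which
one of two Sobolev functions of arbitrarily small norm is at least `1`. -/
theorem cap_eq_zero_of_forall_lt {p : ℝ} (hp : 1 ≤ p) {Ω E : Set (EuclideanSpace ℝ (Fin n))}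
    (hΩ : IsOpen Ω) (hΩb : Bornology.IsBounded Ω) (hE : E ⊆ Ω)
    (h : ∀ ε : ℝ≥0∞, 0 < ε → ∃ (V : Set (EuclideanSpace ℝ (Fin n)))
      (w₁ w₂ : EuclideanSpace ℝ (Fin n) → ℝ)
      (G₁ G₂ : EuclideanSpace ℝ (Fin n) → EuclideanSpace ℝ (Fin n)), IsOpen V ∧ E ⊆ V ∧
      HasWeakGradient univ w₁ G₁ ∧ HasWeakGradient univ w₂ G₂ ∧
      (∀ᵐ x ∂(volume.restrict V), 1 ≤ w₁ x ∨ 1 ≤ w₂ x) ∧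
      (∫⁻ x, (‖w₁ x‖ₑ ^ p + ‖G₁ x‖ₑ ^ p)) + ∫⁻ x, (‖w₂ x‖ₑ ^ p + ‖G₂ x‖ₑ ^ p) < ε) :
    cap p E Ω = 0 := by
  have hp0 : 0 < p := by linarith
  refine le_antisymm (le_of_forall_pos_le_add fun c hc => ?_) zero_le
  rw [zero_add]
  have hε : c ^ p⁻¹ ≠ 0 := (ENNReal.rpow_pos_of_nonneg hc (by positivity)).ne'
  -- The budgets sum to less than c^(1/p), since Minkowski's inequality adds L^p norms and not their
  -- p-th powers.
  obtain ⟨e, he0, hes⟩ := ENNReal.exists_pos_sum_of_countable' hε ℕ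
  let d : ℕ → ℝ≥0∞ := fun j => ((j : ℝ≥0∞) + 1)⁻¹
  have hd : ∀ j, 0 < d j := fun j => by simp [d]
  -- Compact sets Q j with open parts O j exhausting Ω; the cutoff η j equals 1 on Q j.
  let Q : ℕ → Set (EuclideanSpace ℝ (Fin n)) := fun j => {x | d j ≤ Metric.infEDist x Ωᶜ}
  let O : ℕ → Set (EuclideanSpace ℝ (Fin n)) := fun j => {x | d j < Metric.infEDist x Ωᶜ}
  have hO : ∀ j, IsOpen (O j) := fun j =>
    isOpen_lt continuous_const Metric.continuous_infEDist
  have hQΩ : ∀ j, Q j ⊆ Ω := fun j x hx => by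
    by_contra hxΩ
    have h0 : Metric.infEDist x Ωᶜ = 0 := Metric.infEDist_zero_of_mem hxΩ
    exact absurd (hd j) (by simpa [h0, Q] using hx)
  have hQ : ∀ j, IsCompact (Q j) := fun j =>
    Metric.isCompact_of_isClosed_isBounded
      (isClosed_le continuous_const Metric.continuous_infEDist) (hΩb.subset (hQΩ j))
  have hOQ : ∀ j, O j ⊆ Q j := fun j x (hx : d j < _) => hx.le
  have hcover : ∀ x ∈ Ω, ∃ j, x ∈ O j := fun x hx => by
    have hpos : 0 < Metric.infEDist x Ωᶜ := by
      rw [pos_iff_ne_zero, Ne, ← Metric.mem_iff_infEDist_zero_of_closed hΩ.isClosed_compl]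
      exact fun h => h hx
    obtain ⟨j, hj⟩ := ENNReal.exists_inv_nat_lt hpos.ne'
    refine ⟨j, lt_of_le_of_lt ?_ hj⟩
    exact ENNReal.inv_le_inv.2 le_self_add
  choose η hη hη0 hη1 using fun j => exists_isTest_eq_one (hQ j) hΩ (hQΩ j)
  choose C hC hCψ using fun j => exists_isTest_of_hasWeakGradient hp (hη j) (hη0 j)
  -- The neighborhood and the Sobolev pair are chosen after the cutoff constant C j, which may grow
  -- with j. The summand 1 keeps the denominator nonzero.
  have hsmall : ∀ j, 0 < e j ^ p / (C j + 1) := fun j =>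
    ENNReal.div_pos (ENNReal.rpow_pos_of_nonneg (he0 j) hp0.le).ne' (by simp [hC j])
  choose V w₁ w₂ G₁ G₂ hV hEV hw₁ hw₂ hwV hwG using fun j => h _ (hsmall j)
  refine iInf₂_le_of_le (⋃ j, V j ∩ O j) (isOpen_iUnion fun j => (hV j).inter (hO j)) ?_
  refine iInf₂_le_of_le ?_ ?_ ?_
  · intro x hx
    obtain ⟨j, hj⟩ := hcover x (hE hx)
    exact mem_iUnion.2 ⟨j, hEV j hx, hj⟩
  · exact iUnion_subset fun j x hx => hQΩ j (hOQ j hx.2)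
  refine iSup₂_le fun K hK => iSup_le fun hKU => ?_
  obtain ⟨t, ht⟩ := hK.elim_finite_subcover _ (fun j => (hV j).inter (hO j)) hKU
  -- K is split into finitely many compact pieces, each handled by its own ψ j; the sum of the ψ j
  -- is then at least 1 on K.
  obtain ⟨κ, hκ, hκsub, hκK⟩ := hK.finite_compact_cover t (fun j => V j ∩ O j)
    (fun j _ => (hV j).inter (hO j)) ht
  choose ψ hψ hψ0 hψ1 hψe using fun j => hCψ j (w₁ j) (w₂ j) (G₁ j) (G₂ j) (V j) (κ j)
    (hw₁ j) (hw₂ j) (hV j) (hwV j) (hκ j) (fun x hx => (hκsub j hx).1)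
    (fun x hx => hη1 j x (hOQ j (hκsub j hx).2))
  have hψle : ∀ j, eLpNorm (gradient (ψ j)) (ENNReal.ofReal p) volume ≤ e j := by
    intro j
    have h1 : ∫⁻ x, ‖gradient (ψ j) x‖ₑ ^ p ≤ e j ^ p := by
      refine (hψe j).trans ?_
      calc C j * ((∫⁻ x, (‖w₁ j x‖ₑ ^ p + ‖G₁ j x‖ₑ ^ p)) +
            ∫⁻ x, (‖w₂ j x‖ₑ ^ p + ‖G₂ j x‖ₑ ^ p))
          ≤ (C j + 1) * (e j ^ p / (C j + 1)) := by
            gcongr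
            · exact le_self_add
            · exact (hwG j).le
        _ ≤ e j ^ p := ENNReal.mul_div_le
    rw [eLpNorm_eq_lintegral_rpow_enorm_toReal (by simpa using hp0) ENNReal.ofReal_ne_top,
      ENNReal.toReal_ofReal hp0.le, one_div, ENNReal.rpow_inv_le_iff hp0]
    exact h1
  refine iInf₂_le_of_le (fun x => ∑ j ∈ t, ψ j x) ⟨?_, ?_, ?_⟩ (iInf_le_of_le ?_ ?_)
  · exact ContDiff.sum fun j _ => (hψ j).1
  · refine HasCompactSupport.intro (t.finite_toSet.isCompact_biUnion fun j _ => (hψ j).2.1)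
      fun x hx => Finset.sum_eq_zero fun j hj => image_eq_zero_of_notMem_tsupport fun hxj => ?_
    exact hx (mem_biUnion hj hxj)
  · have : tsupport (fun x => ∑ j ∈ t, ψ j x) ⊆ ⋃ j ∈ t, tsupport (ψ j) := by
      refine closure_minimal (fun x hx => ?_)
        (t.finite_toSet.isClosed_biUnion fun j _ => isClosed_tsupport _)
      obtain ⟨j, hj, hxj⟩ := Finset.exists_ne_zero_of_sum_ne_zero hx
      exact mem_biUnion hj (subset_tsupport _ hxj)
    exact this.trans (iUnion₂_subset fun j _ => (hψ j).2.2)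
  · intro x hx
    rw [hκK] at hx
    obtain ⟨j, hj, hxj⟩ := mem_iUnion₂.1 hx
    exact (hψ1 j x hxj).trans (Finset.single_le_sum (fun i _ => hψ0 i x) hj)
  · have h1 : gradient (fun x => ∑ j ∈ t, ψ j x) = ∑ j ∈ t, gradient (ψ j) := by
      ext1 x
      rw [gradient_fun_sum _ fun j _ => (hψ j).1.differentiable (by simp) x, Finset.sum_apply]
    have h2 : eLpNorm (gradient fun x => ∑ j ∈ t, ψ j x) (ENNReal.ofReal p) volume ≤ c ^ p⁻¹ := by
      rw [h1]
      calc _ ≤ ∑ j ∈ t, eLpNorm (gradient (ψ j)) (ENNReal.ofReal p) volume :=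
            eLpNorm_sum_le (fun j _ => (continuous_gradient (hψ j).1).aestronglyMeasurable)
              (by simpa using hp)
        _ ≤ ∑ j ∈ t, e j := Finset.sum_le_sum fun j _ => hψle j
        _ ≤ ∑' j, e j := ENNReal.sum_le_tsum t
        _ ≤ c ^ p⁻¹ := hes.le
    rw [eLpNorm_eq_lintegral_rpow_enorm_toReal (by simpa using hp0) ENNReal.ofReal_ne_top,
      ENNReal.toReal_ofReal hp0.le, one_div, ENNReal.rpow_inv_le_iff hp0,
      ENNReal.rpow_inv_rpow hp0.ne'] at h2
    exact h2

/-- An open relation between two quasicontinuous functions which fails almost everywhere fails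
quasieverywhere. -/
theorem IsQuasicontinuous.quasieverywhere_notMem {p : ℝ} (hp : 1 ≤ p)
    {Ω : Set (EuclideanSpace ℝ (Fin n))} (hΩ : IsOpen Ω) (hΩb : Bornology.IsBounded Ω)
    {u v : EuclideanSpace ℝ (Fin n) → EReal} (hu : IsQuasicontinuous p Ω u)
    (hv : IsQuasicontinuous p Ω v) {R : Set (EReal × EReal)} (hR : IsOpen R)
    (hae : ∀ᵐ x ∂(volume.restrict Ω), (u x, v x) ∉ R) :
    Quasieverywhere p Ω fun x => (u x, v x) ∉ R := by
  have hsob : ∀ {S : Set (EuclideanSpace ℝ (Fin n))} {ε : ℝ≥0∞}, sobolevCap p S < ε →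
      ∃ (w : EuclideanSpace ℝ (Fin n) → ℝ)
        (G : EuclideanSpace ℝ (Fin n) → EuclideanSpace ℝ (Fin n)), HasWeakGradient univ w G ∧
        (∀ᵐ x, x ∈ S → 1 ≤ w x) ∧ ∫⁻ x, (‖w x‖ₑ ^ p + ‖G x‖ₑ ^ p) < ε := by
    intro S ε h
    simp only [sobolevCap, iInf_lt_iff] at h
    obtain ⟨w, G, hw, ⟨U, hU, hSU, hwU⟩, h⟩ := h
    refine ⟨w, G, hw, ?_, h⟩
    filter_upwards [(ae_restrict_iff' hU.measurableSet).1 hwU] with x hx hxS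
    exact hx (hSU hxS)
  refine cap_eq_zero_of_forall_lt hp hΩ hΩb (fun x hx => hx.1) fun ε hε => ?_
  obtain ⟨S₁, hS₁, hS₁c, hu'⟩ := hu (ε / 2) (ENNReal.half_pos hε.ne')
  obtain ⟨S₂, hS₂, hS₂c, hv'⟩ := hv (ε / 2) (ENNReal.half_pos hε.ne')
  obtain ⟨w₁, G₁, hw₁, hwS₁, hw₁ε⟩ := hsob hS₁c
  obtain ⟨w₂, G₂, hw₂, hwS₂, hw₂ε⟩ := hsob hS₂c
  have hcont : ContinuousOn (fun x => (u x, v x)) (Ω \ (S₁ ∪ S₂)) :=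
    (hu'.mono (sdiff_subset_sdiff_right subset_union_left)).prodMk
      (hv'.mono (sdiff_subset_sdiff_right subset_union_right))
  -- Off S₁ ∪ S₂ both functions are continuous, so the relation is cut out of Ω by an open set O.
  obtain ⟨O, hO, hOeq⟩ := continuousOn_iff'.1 hcont R hR
  have hiff : ∀ x ∈ Ω \ (S₁ ∪ S₂), (u x, v x) ∈ R ↔ x ∈ O := fun x hx =>
    ⟨fun h => ((hOeq.subset ⟨h, hx⟩ : _).1), fun h => ((hOeq.superset ⟨h, hx⟩ : _).1)⟩
  -- A point of this open set outside S₁ ∪ S₂ lies in O and satisfies the relation, which happens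
  -- only on a null set. Almost every other point lies in S₁ or S₂, where w₁ ≥ 1 or w₂ ≥ 1.
  refine ⟨Ω ∩ (O ∪ (S₁ ∪ S₂)), w₁, w₂, G₁, G₂, hΩ.inter (hO.union (hS₁.union hS₂)), ?_, hw₁, hw₂,
    ?_, ?_⟩
  · rintro x ⟨hxΩ, hxR⟩
    refine ⟨hxΩ, ?_⟩
    by_cases hxS : x ∈ S₁ ∪ S₂
    · exact Or.inr hxS
    · exact Or.inl ((hiff x ⟨hxΩ, hxS⟩).1 (not_not.1 hxR))
  · rw [ae_restrict_iff' (hΩ.inter (hO.union (hS₁.union hS₂))).measurableSet]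
    filter_upwards [hwS₁, hwS₂, (ae_restrict_iff' hΩ.measurableSet).1 hae] with x h1 h2 h3 hx
    by_cases hx1 : x ∈ S₁
    · exact Or.inl (h1 hx1)
    by_cases hx2 : x ∈ S₂
    · exact Or.inr (h2 hx2)
    · have hxS : x ∉ S₁ ∪ S₂ := fun h => h.elim hx1 hx2
      exact absurd ((hiff x ⟨hx.1, hxS⟩).2 (hx.2.resolve_right hxS)) (h3 hx.1)
  · calc _ < ε / 2 + ε / 2 := ENNReal.add_lt_add hw₁ε hw₂ε
      _ = ε := ENNReal.add_halves ε

end Capacity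

/-! ### Uniqueness of weak gradients, growth of 𝒜, and Poincaré's inequality. -/

section Comparison

variable {n : ℕ}

theorem IsTest.integrable_smul {U : Set (EuclideanSpace ℝ (Fin n))}
    {ψ : EuclideanSpace ℝ (Fin n) → ℝ} (hψ : IsTest U ψ)
    {G : EuclideanSpace ℝ (Fin n) → EuclideanSpace ℝ (Fin n)}
    (hG : LocallyIntegrableOn G U volume) :
    Integrable fun x => ψ x • G x := by
  have h1 : IntegrableOn (fun x => ψ x • G x) (tsupport ψ) volume :=
    (hG.integrableOn_compact_subset hψ.2.2 hψ.2.1).continuousOn_smul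
      hψ.1.continuous.continuousOn hψ.2.1
  refine (integrableOn_iff_integrable_of_support_subset ?_).1 h1
  intro x hx
  refine subset_tsupport _ fun h0 => hx ?_
  simp [h0]

/-- Weak gradients of functions which agree on an open set agree there almost everywhere. -/
theorem HasWeakGradient.ae_eq {U O : Set (EuclideanSpace ℝ (Fin n))} (hO : IsOpen O)
    (hOU : O ⊆ U) {f g : EuclideanSpace ℝ (Fin n) → ℝ}
    {F G : EuclideanSpace ℝ (Fin n) → EuclideanSpace ℝ (Fin n)} (hf : HasWeakGradient U f F)
    (hg : HasWeakGradient U g G) (hfg : ∀ x ∈ O, f x = g x) : ∀ᵐ x, x ∈ O → F x = G x := by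
  have key := hO.ae_eq_zero_of_integral_contDiff_smul_eq_zero (μ := volume)
    (f := fun x => F x - G x) ((hf.2.1.sub hg.2.1).mono_set hOU) ?_
  · filter_upwards [key] with x hx hxO
    exact sub_eq_zero.1 (hx hxO)
  intro ψ hψ hψs hψO
  have ht : IsTest U ψ := ⟨hψ, hψs, hψO.trans hOU⟩
  have h1 := hf.2.2 ψ ht
  have h2 := hg.2.2 ψ ht
  have h3 : ∫ x in U, f x • gradient ψ x = ∫ x in U, g x • gradient ψ x := by
    refine integral_congr_ae (Eventually.of_forall fun x => ?_)
    by_cases hx : x ∈ O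
    · simp [hfg x hx]
    · simp [gradient_eq_zero_of_notMem_tsupport fun h => hx (hψO h)]
  have h4 : ∀ H : EuclideanSpace ℝ (Fin n) → EuclideanSpace ℝ (Fin n),
      ∫ x in U, ψ x • H x = ∫ x, ψ x • H x := fun H => by
    refine setIntegral_eq_integral_of_forall_compl_eq_zero fun x hx => ?_
    simp [image_eq_zero_of_notMem_tsupport fun h => hx (ht.2.2 h)]
  rw [h1, h2, neg_inj, h4, h4] at h3
  simp only [smul_sub]
  rw [integral_sub (ht.integrable_smul hf.2.1) (ht.integrable_smul hg.2.1), h3, sub_self]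

/-- A Carathéodory function composed with a measurable function is measurable. -/
theorem IsPLaplaceType.aestronglyMeasurable {p : ℝ} {Ω : Set (EuclideanSpace ℝ (Fin n))}
    {A : EuclideanSpace ℝ (Fin n) → EuclideanSpace ℝ (Fin n) → EuclideanSpace ℝ (Fin n)}
    (hA : IsPLaplaceType p Ω A) (hΩ : IsOpen Ω)
    {G : EuclideanSpace ℝ (Fin n) → EuclideanSpace ℝ (Fin n)}
    (hG : AEStronglyMeasurable G (volume.restrict Ω)) :
    AEStronglyMeasurable (fun x => A x (G x)) (volume.restrict Ω) := by
  obtain ⟨G', hG', hGG'⟩ := hG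
  suffices h : AEStronglyMeasurable (fun x => A x (G' x)) (volume.restrict Ω) by
    refine h.congr ?_
    filter_upwards [hGG'] with x hx
    rw [hx]
  -- Simple functions approximate G' pointwise, and 𝒜(x, ·) is continuous. On each level set of a
  -- simple function, 𝒜 is evaluated at a constant vector.
  refine aestronglyMeasurable_of_tendsto_ae (u := atTop)
    (f := fun k x => A x (hG'.approx k x)) (fun k => ?_) ?_
  · have heq : (fun x => A x (hG'.approx k x)) = ∑ z ∈ (hG'.approx k).range,
        (hG'.approx k ⁻¹' {z}).indicator (fun x => A x z) := by
      ext1 x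
      rw [Finset.sum_apply, Finset.sum_eq_single (hG'.approx k x)]
      · rw [indicator_of_mem (by simp)]
      · intro z _ hz
        exact indicator_of_notMem (fun h => hz (by simpa using h.symm)) _
      · intro h
        exact absurd (SimpleFunc.mem_range_self _ x) h
    rw [heq]
    refine Finset.aestronglyMeasurable_sum _ fun z _ => ?_
    exact (hA.measurable z).aestronglyMeasurable.indicator ((hG'.approx k).measurableSet_fiber z)
  · filter_upwards [ae_restrict_mem hΩ.measurableSet] with x hx
    exact ((hA.continuous x hx).tendsto _).comp (hG'.tendsto_approx x)

/-- By the growth condition |𝒜(x, G)| ≤ L|G|^(p-1), and |G|^(p-1) lies in L^(p/(p-1)). Thus 𝒜(x, G)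
pairs with L^p gradients by Hölder's inequality. -/
theorem IsPLaplaceType.memLp {p : ℝ} (hp : 1 < p) {Ω : Set (EuclideanSpace ℝ (Fin n))}
    {A : EuclideanSpace ℝ (Fin n) → EuclideanSpace ℝ (Fin n) → EuclideanSpace ℝ (Fin n)}
    (hA : IsPLaplaceType p Ω A) (hΩ : IsOpen Ω)
    {G : EuclideanSpace ℝ (Fin n) → EuclideanSpace ℝ (Fin n)}
    (hG : MemLp G (ENNReal.ofReal p) (volume.restrict Ω)) :
    MemLp (fun x => A x (G x)) (ENNReal.ofReal (p / (p - 1))) (volume.restrict Ω) := by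
  obtain ⟨L, hL, hgrowth⟩ := hA.growth
  have h1 := (hG.norm_rpow_div (ENNReal.ofReal (p - 1))).const_mul L
  rw [← ENNReal.ofReal_div_of_pos (by linarith), ENNReal.toReal_ofReal (by linarith)] at h1
  refine h1.mono (hA.aestronglyMeasurable hΩ hG.1) ?_
  filter_upwards [ae_restrict_mem hΩ.measurableSet] with x hx
  exact (hgrowth x hx _).trans (le_abs_self _)

theorem IsTest.memLp_gradient {Ω : Set (EuclideanSpace ℝ (Fin n))}
    {ψ : EuclideanSpace ℝ (Fin n) → ℝ} (hψ : IsTest Ω ψ) (q : ℝ≥0∞)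
    (s : Set (EuclideanSpace ℝ (Fin n))) : MemLp (gradient ψ) q (volume.restrict s) :=
  ((continuous_gradient hψ.1).memLp_of_hasCompactSupport (HasCompactSupport.intro hψ.2.1
    fun _ hx => gradient_eq_zero_of_notMem_tsupport hx)).restrict s

/-- A Poincaré inequality for test functions on a bounded set. -/
theorem exists_lintegral_enorm_le_eLpNorm_gradient (hn : 2 ≤ n) {p : ℝ} (hp : 1 ≤ p)
    {Ω : Set (EuclideanSpace ℝ (Fin n))} (hΩb : Bornology.IsBounded Ω) :
    ∃ C : ℝ≥0∞, C ≠ ⊤ ∧ ∀ ψ : EuclideanSpace ℝ (Fin n) → ℝ, IsTest Ω ψ →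
      ∫⁻ x, ‖ψ x‖ₑ ≤ C * eLpNorm (gradient ψ) (ENNReal.ofReal p) (volume.restrict Ω) := by
  have hfin : IsFiniteMeasure (volume.restrict Ω) := ⟨by simpa using hΩb.measure_lt_top⟩
  refine ⟨eLpNormLESNormFDerivOfLeConst ℝ volume Ω 1 1 *
    (volume.restrict Ω) univ ^ (1 / (1 : ℝ≥0∞).toReal - 1 / (ENNReal.ofReal p).toReal),
    ENNReal.mul_ne_top ENNReal.coe_ne_top (ENNReal.rpow_ne_top_of_nonneg ?_ (measure_ne_top _ _)),
    fun ψ hψ => ?_⟩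
  · rw [ENNReal.toReal_ofReal (by linarith), ENNReal.toReal_one, sub_nonneg, div_one]
    exact div_le_one_of_le₀ hp (by linarith)
  -- The inequality requires an exponent below the dimension, so it is used with exponent 1 < n;
  -- Hölder on the bounded set Ω then raises the gradient side to p.
  have h1 := eLpNorm_le_eLpNorm_fderiv (μ := volume) (F := ℝ) (s := Ω) (p := 1)
    (hψ.1.of_le (by simp)) ((subset_tsupport ψ).trans hψ.2.2) le_rfl
    (by rw [finrank_euclideanSpace_fin]; exact_mod_cast hn) hΩb
  rw [ENNReal.coe_one, eLpNorm_one_eq_lintegral_enorm] at h1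
  refine h1.trans ?_
  rw [mul_assoc]
  gcongr
  have h2 : eLpNorm (fderiv ℝ ψ) 1 volume = eLpNorm (gradient ψ) 1 volume := by
    refine eLpNorm_congr_norm_ae (Eventually.of_forall fun x => ?_)
    rw [gradient, LinearIsometryEquiv.norm_map]
  rw [h2, ← eLpNorm_restrict_eq_of_support_subset (s := Ω), mul_comm]
  · exact eLpNorm_le_eLpNorm_mul_rpow_measure_univ (by simpa using hp)
      (continuous_gradient hψ.1).aestronglyMeasurable
  · intro x hx
    refine hψ.2.2 ?_
    by_contra h
    exact hx (gradient_eq_zero_of_notMem_tsupport h)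

/-- Each t ≤ 0 is a minimum point, which also covers t = 0. -/
theorem deriv_smoothTransition_of_nonpos {t : ℝ} (ht : t ≤ 0) :
    deriv Real.smoothTransition t = 0 := by
  refine IsLocalMin.deriv_eq_zero (Eventually.of_forall fun s => ?_)
  rw [Real.smoothTransition.zero_of_nonpos ht]
  exact Real.smoothTransition.nonneg s

end Comparison

/-! ### Testing with smooth truncations. -/

section AlmostEverywhere

variable {n : ℕ}

/-- Convergence of smooth truncations of test functions, together with their gradients. -/
theorem tendsto_eLpNorm_gradient_truncation {p : ℝ} (hp : 1 < p)
    {Ω : Set (EuclideanSpace ℝ (Fin n))} (hΩ : IsOpen Ω) (hΩb : Bornology.IsBounded Ω)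
    {h : EuclideanSpace ℝ (Fin n) → ℝ} {H : EuclideanSpace ℝ (Fin n) → EuclideanSpace ℝ (Fin n)}
    {f : ℕ → EuclideanSpace ℝ (Fin n) → ℝ} (hf : ∀ k, IsTest Ω (f k))
    (hhm : AEStronglyMeasurable h (volume.restrict Ω))
    (hH : MemLp H (ENNReal.ofReal p) (volume.restrict Ω))
    (hfh : ∀ᵐ x ∂(volume.restrict Ω), Tendsto (fun k => f k x) atTop (𝓝 (h x)))
    (hfH : Tendsto (fun k => eLpNorm (fun x => gradient (f k) x - H x) (ENNReal.ofReal p)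
      (volume.restrict Ω)) atTop (𝓝 0))
    {η : EuclideanSpace ℝ (Fin n) → ℝ} (hη : ContDiff ℝ ∞ η) (hη0 : ∀ x, 0 ≤ η x)
    (hη1 : ∀ x, η x ≤ 1) (ε : ℝ) :
    Tendsto (fun k => eLpNorm (fun x =>
        gradient (fun y => η y * Real.smoothTransition (f k y - ε)) x -
        (η x • deriv Real.smoothTransition (h x - ε) • H x +
          Real.smoothTransition (h x - ε) • gradient η x)) (ENNReal.ofReal p)
      (volume.restrict Ω)) atTop (𝓝 0) := by
  obtain ⟨D, hD0, hD⟩ := exists_norm_deriv_smoothTransition_le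
  have hfin : IsFiniteMeasure (volume.restrict Ω) := ⟨by simpa using hΩb.measure_lt_top⟩
  have hP0 : ENNReal.ofReal p ≠ 0 := by simpa using (by linarith : 0 < p)
  have hP1 : 1 ≤ ENNReal.ofReal p := by simpa using hp.le
  have hT : ContDiff ℝ ∞ Real.smoothTransition := Real.smoothTransition.contDiff
  have hT' : Continuous (deriv Real.smoothTransition) := hT.continuous_deriv (by simp)
  obtain ⟨M, hM⟩ := hΩb.isCompact_closure.exists_bound_of_continuousOn
    (continuous_gradient hη).continuousOn
  let T := Real.smoothTransition
  -- The error splits in two. In a k, the L^p-small factor ∇f k - H has a bounded coefficient. In c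
  -- k, the fixed fields H and ∇η have bounded coefficients tending to 0 a.e., and dominated
  -- convergence applies.
  let a : ℕ → EuclideanSpace ℝ (Fin n) → EuclideanSpace ℝ (Fin n) := fun k x =>
    (η x * deriv T (f k x - ε)) • (gradient (f k) x - H x)
  let c : ℕ → EuclideanSpace ℝ (Fin n) → EuclideanSpace ℝ (Fin n) := fun k x =>
    (η x * (deriv T (f k x - ε) - deriv T (h x - ε))) • H x +
      (T (f k x - ε) - T (h x - ε)) • gradient η x
  have hgrad : ∀ k x, gradient (fun y => η y * T (f k y - ε)) x -
      (η x • deriv T (h x - ε) • H x + T (h x - ε) • gradient η x) = a k x + c k x := by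
    intro k x
    have hd : DifferentiableAt ℝ (fun y => f k y - ε) x :=
      ((hf k).1.differentiable (by simp) x).sub_const ε
    have hg : gradient (fun y => f k y - ε) x = gradient (f k) x := by
      simp only [gradient, fderiv_sub_const]
    rw [gradient_fun_mul (hη.differentiable (by simp) x)
      ((hT.differentiable (by simp) _).fun_comp' x hd),
      gradient_fun_comp (hT.differentiable (by simp) _) hd, hg]
    simp only [a, c]
    module
  have hfc : ∀ k, AEStronglyMeasurable (f k) (volume.restrict Ω) := fun k =>
    (hf k).1.continuous.aestronglyMeasurable
  have hηm : AEStronglyMeasurable η (volume.restrict Ω) := hη.continuous.aestronglyMeasurable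
  have hT'f : ∀ k, AEStronglyMeasurable (fun x => deriv T (f k x - ε)) (volume.restrict Ω) :=
    fun k => hT'.comp_aestronglyMeasurable ((hfc k).sub aestronglyMeasurable_const)
  have hT'h : AEStronglyMeasurable (fun x => deriv T (h x - ε)) (volume.restrict Ω) :=
    hT'.comp_aestronglyMeasurable (hhm.sub aestronglyMeasurable_const)
  have hTf : ∀ k, AEStronglyMeasurable (fun x => T (f k x - ε)) (volume.restrict Ω) :=
    fun k => hT.continuous.comp_aestronglyMeasurable ((hfc k).sub aestronglyMeasurable_const)
  have hTh : AEStronglyMeasurable (fun x => T (h x - ε)) (volume.restrict Ω) :=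
    hT.continuous.comp_aestronglyMeasurable (hhm.sub aestronglyMeasurable_const)
  have hηgm : AEStronglyMeasurable (gradient η) (volume.restrict Ω) :=
    (continuous_gradient hη).aestronglyMeasurable
  have ham : ∀ k, AEStronglyMeasurable (a k) (volume.restrict Ω) := fun k =>
    (hηm.mul (hT'f k)).smul ((continuous_gradient (hf k).1).aestronglyMeasurable.sub hH.1)
  have hcm : ∀ k, AEStronglyMeasurable (c k) (volume.restrict Ω) := fun k =>
    ((hηm.mul ((hT'f k).sub hT'h)).smul hH.1).add (((hTf k).sub hTh).smul hηgm)
  have ha : Tendsto (fun k => eLpNorm (a k) (ENNReal.ofReal p) (volume.restrict Ω)) atTop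
      (𝓝 0) := by
    have h1 := ENNReal.Tendsto.const_mul (a := ENNReal.ofReal D) hfH
      (Or.inr ENNReal.ofReal_ne_top)
    rw [mul_zero] at h1
    refine tendsto_of_tendsto_of_tendsto_of_le_of_le tendsto_const_nhds h1 (fun _ => zero_le)
      fun k => ?_
    refine eLpNorm_le_mul_eLpNorm_of_ae_le_mul (Eventually.of_forall fun x => ?_) _
    rw [norm_smul]
    gcongr
    rw [norm_mul, Real.norm_of_nonneg (hη0 x)]
    calc η x * ‖deriv T (f k x - ε)‖ ≤ 1 * D := by
          gcongr
          · exact hη1 x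
          · exact hD _
      _ = D := one_mul D
  have hc : Tendsto (fun k => eLpNorm (c k) (ENNReal.ofReal p) (volume.restrict Ω)) atTop
      (𝓝 0) := by
    refine tendsto_eLpNorm_zero_of_dominated hP0 ENNReal.ofReal_ne_top
      (g := fun x => 2 * D * ‖H x‖ + M) hcm ((hH.norm.const_mul _).add (memLp_const M))
      (fun k => ?_) ?_
    · filter_upwards [ae_restrict_mem hΩ.measurableSet] with x hx
      have h1 : |deriv T (f k x - ε) - deriv T (h x - ε)| ≤ 2 * D := by
        have := abs_sub (deriv T (f k x - ε)) (deriv T (h x - ε))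
        linarith [hD (f k x - ε), hD (h x - ε)]
      have h2 : |T (f k x - ε) - T (h x - ε)| ≤ 1 := by
        rw [abs_le]
        constructor <;>
        linarith [Real.smoothTransition.nonneg (f k x - ε), Real.smoothTransition.nonneg (h x - ε),
          Real.smoothTransition.le_one (f k x - ε), Real.smoothTransition.le_one (h x - ε)]
      refine (norm_add_le _ _).trans ?_
      rw [norm_smul, norm_smul, norm_mul, Real.norm_of_nonneg (hη0 x)]
      have h3 : η x * ‖deriv T (f k x - ε) - deriv T (h x - ε)‖ ≤ 2 * D :=
        (mul_le_of_le_one_left (norm_nonneg _) (hη1 x)).trans h1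
      have h4 := (mul_le_of_le_one_left (norm_nonneg (gradient η x)) h2).trans
        (hM x (subset_closure hx))
      have h5 := mul_le_mul_of_nonneg_right h3 (norm_nonneg (H x))
      exact add_le_add h5 h4
    · filter_upwards [hfh] with x hx
      have h1 : Tendsto (fun k => f k x - ε) atTop (𝓝 (h x - ε)) := hx.sub_const ε
      have h2 := (hT'.tendsto _).comp h1
      have h3 := (hT.continuous.tendsto _).comp h1
      have h4 := (((h2.sub_const (deriv T (h x - ε))).const_mul (η x)).smul_const (H x)).add
        ((h3.sub_const (T (h x - ε))).smul_const (gradient η x))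
      simpa [T, c, Function.comp_def] using h4
  have hsum := ha.add hc
  rw [add_zero] at hsum
  refine tendsto_of_tendsto_of_tendsto_of_le_of_le tendsto_const_nhds hsum (fun _ => zero_le)
    fun k => ?_
  rw [show (fun x => gradient (fun y => η y * Real.smoothTransition (f k y - ε)) x -
    (η x • deriv Real.smoothTransition (h x - ε) • H x +
      Real.smoothTransition (h x - ε) • gradient η x)) = a k + c k from funext (hgrad k)]
  exact eLpNorm_add_le (ham k) (hcm k) hP1

theorem integrable_inner_of_holderConjugate {p q : ℝ} (hpq : q.HolderConjugate p)
    {μ : Measure (EuclideanSpace ℝ (Fin n))}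
    {B Z : EuclideanSpace ℝ (Fin n) → EuclideanSpace ℝ (Fin n)}
    (hB : MemLp B (ENNReal.ofReal q) μ) (hZ : MemLp Z (ENNReal.ofReal p) μ) :
    Integrable (fun x => inner ℝ (B x) (Z x)) μ := by
  have := hpq.ennrealOfReal
  rw [← memLp_one_iff_integrable]
  refine MemLp.of_bilin (fun x y => inner ℝ x y) 1 hB hZ (hB.1.inner hZ.1)
    (Eventually.of_forall fun x => ?_)
  rw [one_mul]
  exact nnnorm_inner_le_nnnorm _ _

theorem tendsto_integral_inner {p q : ℝ} (hpq : q.HolderConjugate p)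
    {μ : Measure (EuclideanSpace ℝ (Fin n))}
    {B Z : EuclideanSpace ℝ (Fin n) → EuclideanSpace ℝ (Fin n)}
    {g : ℕ → EuclideanSpace ℝ (Fin n) → EuclideanSpace ℝ (Fin n)}
    (hB : MemLp B (ENNReal.ofReal q) μ) (hZ : MemLp Z (ENNReal.ofReal p) μ)
    (hg : ∀ k, MemLp (g k) (ENNReal.ofReal p) μ)
    (hlim : Tendsto (fun k => eLpNorm (fun x => g k x - Z x) (ENNReal.ofReal p) μ) atTop (𝓝 0)) :
    Tendsto (fun k => ∫ x, inner ℝ (B x) (g k x) ∂μ) atTop (𝓝 (∫ x, inner ℝ (B x) (Z x) ∂μ)) := by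
  have := hpq.ennrealOfReal
  refine tendsto_integral_of_L1' _ (integrable_inner_of_holderConjugate hpq hB hZ).1
    (Eventually.of_forall fun k => integrable_inner_of_holderConjugate hpq hB (hg k)) ?_
  have h1 := ENNReal.Tendsto.const_mul (a := eLpNorm B (ENNReal.ofReal q) μ) hlim (Or.inr hB.2.ne)
  rw [mul_zero] at h1
  refine tendsto_of_tendsto_of_tendsto_of_le_of_le tendsto_const_nhds h1 (fun _ => zero_le)
    fun k => ?_
  have h2 : (fun x => inner ℝ (B x) (g k x)) - (fun x => inner ℝ (B x) (Z x)) =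
      fun x => inner ℝ (B x) (g k x - Z x) := by
    ext x
    simp [inner_sub_right]
  rw [h2]
  have h3 := eLpNorm_le_eLpNorm_mul_eLpNorm_of_nnnorm (p := ENNReal.ofReal q)
    (q := ENNReal.ofReal p) (r := 1) hB.1 ((hg k).1.sub hZ.1)
    (fun x y => (inner ℝ x y : ℝ)) 1 (Eventually.of_forall fun x => by
      rw [one_mul]
      exact nnnorm_inner_le_nnnorm _ _)
  rw [ENNReal.coe_one, one_mul] at h3
  exact h3

/-- If the monotonicity inequality can be tested with truncations of a function `h` that is
approximated by test functions, then `h ≤ ε` almost everywhere. -/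
theorem IsPLaplaceType.ae_le_of_test (hn : 2 ≤ n) {p : ℝ} (hp : 1 < p)
    {Ω : Set (EuclideanSpace ℝ (Fin n))} (hΩ : IsOpen Ω) (hΩb : Bornology.IsBounded Ω)
    {A : EuclideanSpace ℝ (Fin n) → EuclideanSpace ℝ (Fin n) → EuclideanSpace ℝ (Fin n)}
    (hA : IsPLaplaceType p Ω A) {h : EuclideanSpace ℝ (Fin n) → ℝ}
    {G₁ G₂ : EuclideanSpace ℝ (Fin n) → EuclideanSpace ℝ (Fin n)}
    {f : ℕ → EuclideanSpace ℝ (Fin n) → ℝ} (hf : ∀ k, IsTest Ω (f k))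
    (hhm : AEStronglyMeasurable h (volume.restrict Ω))
    (hG₁ : MemLp G₁ (ENNReal.ofReal p) (volume.restrict Ω))
    (hG₂ : MemLp G₂ (ENNReal.ofReal p) (volume.restrict Ω))
    (hfh : Tendsto (fun k => eLpNorm (fun x => f k x - h x) (ENNReal.ofReal p)
      (volume.restrict Ω)) atTop (𝓝 0))
    (hfH : Tendsto (fun k => eLpNorm (fun x => gradient (f k) x - (G₁ x - G₂ x))
      (ENNReal.ofReal p) (volume.restrict Ω)) atTop (𝓝 0))
    {η : EuclideanSpace ℝ (Fin n) → ℝ} (hη : ContDiff ℝ ∞ η) (hη0 : ∀ x, 0 ≤ η x)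
    (hη1 : ∀ x, η x ≤ 1) {ε : ℝ} (hε : 0 < ε)
    (hηh : ∀ᵐ x ∂(volume.restrict Ω), h x ≤ ε ∨ η x = 1 ∧ gradient η x = 0)
    (htest : ∀ ψ : EuclideanSpace ℝ (Fin n) → ℝ, IsTest Ω ψ → (∀ x, 0 ≤ ψ x) →
      ∫ x in Ω, inner ℝ (A x (G₁ x) - A x (G₂ x)) (gradient (fun y => η y * ψ y) x) ≤ 0) :
    ∀ᵐ x ∂(volume.restrict Ω), h x ≤ ε := by
  have hfin : IsFiniteMeasure (volume.restrict Ω) := ⟨by simpa using hΩb.measure_lt_top⟩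
  have hP0 : ENNReal.ofReal p ≠ 0 := by simpa using (by linarith : 0 < p)
  have hT : ContDiff ℝ ∞ Real.smoothTransition := Real.smoothTransition.contDiff
  obtain ⟨ns, hns, hae⟩ := (tendstoInMeasure_of_tendsto_eLpNorm hP0
    (fun k => (hf k).1.continuous.aestronglyMeasurable) hhm hfh).exists_seq_tendsto_ae
  have hH : MemLp (fun x => G₁ x - G₂ x) (ENNReal.ofReal p) (volume.restrict Ω) := hG₁.sub hG₂
  set T := Real.smoothTransition with hTdef
  set Z : EuclideanSpace ℝ (Fin n) → EuclideanSpace ℝ (Fin n) := fun x =>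
    η x • deriv T (h x - ε) • (G₁ x - G₂ x) + T (h x - ε) • gradient η x with hZdef
  -- Since T(-ε) = 0, ψ k vanishes wherever f (ns k) does and is again a test function.
  let ψ : ℕ → EuclideanSpace ℝ (Fin n) → ℝ := fun k y => T (f (ns k) y - ε)
  have hψ : ∀ k, IsTest Ω (ψ k) := fun k => by
    have hsub : tsupport (ψ k) ⊆ tsupport (f (ns k)) := by
      refine closure_mono fun x hx hx0 => hx ?_
      simp only [ψ, hx0, zero_sub]
      exact Real.smoothTransition.zero_of_nonpos (by linarith)
    exact ⟨hT.comp ((hf (ns k)).1.sub contDiff_const),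
      (hf (ns k)).2.1.of_isClosed_subset (isClosed_tsupport _) hsub,
      hsub.trans (hf (ns k)).2.2⟩
  have hψ0 : ∀ k x, 0 ≤ ψ k x := fun k x => Real.smoothTransition.nonneg _
  have hηψ : ∀ k, IsTest Ω (fun y => η y * ψ k y) := fun k =>
    ⟨hη.mul (hψ k).1, (hψ k).2.1.mul_left, tsupport_mul_subset_right.trans (hψ k).2.2⟩
  have hlim := tendsto_eLpNorm_gradient_truncation hp hΩ hΩb (fun k => hf (ns k)) hhm hH hae
    (hfH.comp hns.tendsto_atTop) hη hη0 hη1 ε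
  -- The cutoff disappears in the limit: where h ≤ ε, both T and T' vanish at h - ε, and elsewhere η
  -- = 1 and ∇η = 0.
  have hZeq : ∀ᵐ x ∂(volume.restrict Ω), Z x = deriv T (h x - ε) • (G₁ x - G₂ x) := by
    filter_upwards [hηh] with x hx
    rcases hx with hx | ⟨h1, h2⟩
    · simp [hZdef, hTdef, deriv_smoothTransition_of_nonpos (sub_nonpos.2 hx),
        Real.smoothTransition.zero_of_nonpos (sub_nonpos.2 hx)]
    · simp [hZdef, h1, h2]
  obtain ⟨D, hD0, hD⟩ := exists_norm_deriv_smoothTransition_le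
  have hZ : MemLp Z (ENNReal.ofReal p) (volume.restrict Ω) := by
    have hm : AEStronglyMeasurable (fun x => deriv T (h x - ε) • (G₁ x - G₂ x))
        (volume.restrict Ω) :=
      ((hT.continuous_deriv (by simp)).comp_aestronglyMeasurable
        (hhm.sub aestronglyMeasurable_const)).smul hH.1
    refine MemLp.of_le_mul (c := D) hH (hm.congr (hZeq.mono fun x hx => hx.symm)) ?_
    filter_upwards [hZeq] with x hx
    rw [hx, norm_smul]
    exact mul_le_mul_of_nonneg_right (hD _) (norm_nonneg _)
  have hB : MemLp (fun x => A x (G₁ x) - A x (G₂ x)) (ENNReal.ofReal (p / (p - 1)))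
      (volume.restrict Ω) := (hA.memLp hp hΩ hG₁).sub (hA.memLp hp hΩ hG₂)
  have hpq : (p / (p - 1)).HolderConjugate p := (Real.HolderConjugate.conjExponent hp).symm
  have hle : ∫ x in Ω, inner ℝ (A x (G₁ x) - A x (G₂ x)) (Z x) ≤ 0 :=
    le_of_tendsto' (tendsto_integral_inner hpq hB hZ (fun k => (hηψ k).memLp_gradient _ _) hlim)
      fun k => htest (ψ k) (hψ k) (hψ0 k)
  have hmono : ∀ x ∈ Ω, 0 ≤ inner ℝ (A x (G₁ x) - A x (G₂ x)) (G₁ x - G₂ x) := fun x hx => by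
    by_cases heq : G₁ x = G₂ x
    · simp [heq]
    · exact (hA.monotone x hx _ _ heq).le
  have hT'0 : ∀ t, 0 ≤ deriv T t := fun t => Real.smoothTransition.monotone.deriv_nonneg
  have hpos : 0 ≤ᵐ[volume.restrict Ω] fun x => inner ℝ (A x (G₁ x) - A x (G₂ x)) (Z x) := by
    filter_upwards [hZeq, ae_restrict_mem hΩ.measurableSet] with x hx hxΩ
    rw [hx, inner_smul_right]
    exact mul_nonneg (hT'0 _) (hmono x hxΩ)
  have hzero := (integral_eq_zero_iff_of_nonneg_ae hpos
    (integrable_inner_of_holderConjugate hpq hB hZ)).1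
    (le_antisymm hle (integral_nonneg_of_ae hpos))
  -- The integrand is nonnegative with integral at most 0, hence zero a.e.; where G₁ ≠ G₂, strict
  -- monotonicity leaves only T'(h - ε) = 0.
  have hZ0 : ∀ᵐ x ∂(volume.restrict Ω), Z x = 0 := by
    filter_upwards [hzero, hZeq, ae_restrict_mem hΩ.measurableSet] with x h0 hx hxΩ
    rw [hx, inner_smul_right] at h0
    rw [hx]
    by_cases heq : G₁ x = G₂ x
    · simp [heq]
    · rcases mul_eq_zero.1 h0 with h0 | h0
      · simp [h0]
      · exact absurd h0 (hA.monotone x hxΩ _ _ heq).ne'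
  -- As the limit Z is zero, Poincaré's inequality is needed only for the smooth functions ηψ k, and
  -- no chain rule for h is involved.
  have hgrad0 : Tendsto (fun k => eLpNorm (gradient fun y => η y * ψ k y) (ENNReal.ofReal p)
      (volume.restrict Ω)) atTop (𝓝 0) := by
    refine hlim.congr fun k => eLpNorm_congr_ae ?_
    filter_upwards [hZ0] with x hx
    have hx' : η x • deriv Real.smoothTransition (h x - ε) • (G₁ x - G₂ x) +
      Real.smoothTransition (h x - ε) • gradient η x = 0 := hx
    rw [hx', sub_zero]
  obtain ⟨C, hC, hpoin⟩ := exists_lintegral_enorm_le_eLpNorm_gradient hn hp.le hΩb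
  have hint0 : Tendsto (fun k => ∫⁻ x in Ω, ‖η x * ψ k x‖ₑ) atTop (𝓝 0) := by
    have h1 := ENNReal.Tendsto.const_mul (a := C) hgrad0 (Or.inr hC)
    rw [mul_zero] at h1
    exact tendsto_of_tendsto_of_tendsto_of_le_of_le tendsto_const_nhds h1 (fun _ => zero_le)
      fun k => (setLIntegral_le_lintegral _ _).trans (hpoin _ (hηψ k))
  have hfatou : ∫⁻ x in Ω, ‖η x * T (h x - ε)‖ₑ ≤ 0 := by
    calc ∫⁻ x in Ω, ‖η x * T (h x - ε)‖ₑ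
        = ∫⁻ x in Ω, liminf (fun k => ‖η x * ψ k x‖ₑ) atTop := by
          refine lintegral_congr_ae ?_
          filter_upwards [hae] with x hx
          refine (Tendsto.liminf_eq ?_).symm
          exact (((hT.continuous.tendsto _).comp (hx.sub_const ε)).const_mul (η x)).enorm
      _ ≤ liminf (fun k => ∫⁻ x in Ω, ‖η x * ψ k x‖ₑ) atTop :=
          lintegral_liminf_le fun k => (hηψ k).1.continuous.measurable.enorm
      _ = 0 := hint0.liminf_eq
  have hm : AEMeasurable (fun x => ‖η x * T (h x - ε)‖ₑ) (volume.restrict Ω) :=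
    (hη.continuous.aestronglyMeasurable.mul (hT.continuous.comp_aestronglyMeasurable
      (hhm.sub aestronglyMeasurable_const))).enorm
  filter_upwards [(lintegral_eq_zero_iff' hm).1 (le_antisymm hfatou zero_le), hηh] with x h0 hx
  rcases hx with hx | ⟨h1, -⟩
  · exact hx
  · have h2 : T (h x - ε) = 0 := by simpa [h1] using h0
    exact sub_nonpos.1 (Real.smoothTransition.zero_iff_nonpos.1 h2)

end AlmostEverywhere

/-! ### Smallness near Γ and the comparison principle. -/

section Main

variable {n : ℕ}

theorem exists_pos_mul_rpow_le {M c : ℝ≥0∞} (hM : M ≠ ⊤) (hc : 0 < c) {β : ℝ} (hβ : 0 < β) :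
    ∃ r : ℝ≥0∞, 0 < r ∧ r ≠ ⊤ ∧ M * r ^ β ≤ c := by
  have hpos : 0 < min 1 (c / (M + 1)) :=
    lt_min one_pos (ENNReal.div_pos hc.ne' (by simp [hM]))
  -- The minimum with 1 keeps r finite when c = ⊤, and M + 1 avoids division by zero.
  refine ⟨min 1 (c / (M + 1)) ^ β⁻¹, ENNReal.rpow_pos_of_nonneg hpos (by positivity),
    ENNReal.rpow_ne_top_of_nonneg (by positivity)
      (ne_top_of_le_ne_top ENNReal.one_ne_top (min_le_left _ _)), ?_⟩
  rw [ENNReal.rpow_inv_rpow hβ.ne']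
  calc M * min 1 (c / (M + 1)) ≤ (M + 1) * (c / (M + 1)) := by
        gcongr
        · exact le_self_add
        · exact min_le_right _ _
    _ ≤ c := ENNReal.mul_div_le

/-- Only an inequality, because `EReal.toReal` sends ±∞ to 0. -/
theorem ofReal_abs_toReal_le (a : EReal) : ENNReal.ofReal |a.toReal| ≤ a.abs := by
  induction a with
  | bot => simp
  | coe x => simp [EReal.abs_def]
  | top => simp

/-- Functions in the weighted space are uniformly small near `Γ`. -/
theorem MemLinftyWeighted.exists_ae_abs_toReal_le {β : ℝ} (hβ : 0 < β)
    {Ω Γ : Set (EuclideanSpace ℝ (Fin n))} (hΩ : IsOpen Ω) (hΓ : IsClosed Γ)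
    (hΓΩ : Γ ⊆ frontier Ω) {u : EuclideanSpace ℝ (Fin n) → EReal}
    (hu : MemLinftyWeighted β Ω Γ u) {ε : ℝ} (hε : 0 < ε) :
    ∃ r : ℝ≥0∞, 0 < r ∧ ∀ᵐ x ∂(volume.restrict Ω), Metric.infEDist x Γ ≤ r →
      |(u x).toReal| ≤ ε := by
  obtain ⟨r, hr0, hrt, hr⟩ := exists_pos_mul_rpow_le hu.2.2.ne (ENNReal.ofReal_pos.2 hε) hβ
  refine ⟨r, hr0, ?_⟩
  filter_upwards [ENNReal.ae_le_essSup (μ := volume.restrict Ω)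
    (fun x => (u x).abs / Metric.infEDist x Γ ^ β), ae_restrict_mem hΩ.measurableSet]
    with x hx hxΩ hxr
  -- Γ lies on the boundary of the open set Ω and so does not meet Ω.
  have hxΓ : Metric.infEDist x Γ ≠ 0 := by
    rw [Ne, ← Metric.mem_iff_infEDist_zero_of_closed hΓ]
    intro h
    have := (hΓΩ h).2
    rw [hΩ.interior_eq] at this
    exact this hxΩ
  have hd0 : Metric.infEDist x Γ ^ β ≠ 0 :=
    (ENNReal.rpow_pos_of_nonneg (pos_iff_ne_zero.2 hxΓ) hβ.le).ne'
  -- Finiteness of r enters here. For empty Γ the distance is ∞ and the condition on x is never met.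
  have hdt : Metric.infEDist x Γ ^ β ≠ ⊤ :=
    ENNReal.rpow_ne_top_of_nonneg hβ.le (ne_top_of_le_ne_top hrt hxr)
  rw [ENNReal.div_le_iff hd0 hdt] at hx
  have h1 : ENNReal.ofReal |(u x).toReal| ≤ ENNReal.ofReal ε :=
    calc _ ≤ (u x).abs := ofReal_abs_toReal_le _
      _ ≤ _ := hx
      _ ≤ _ := by gcongr
      _ ≤ _ := hr
  exact (ENNReal.ofReal_le_ofReal_iff hε.le).1 h1

theorem MemLinftyWeighted.ae_coe_toReal {β : ℝ} {Ω Γ : Set (EuclideanSpace ℝ (Fin n))}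
    {u : EuclideanSpace ℝ (Fin n) → EReal} (hu : MemLinftyWeighted β Ω Γ u) :
    ∀ᵐ x ∂(volume.restrict Ω), ((u x).toReal : EReal) = u x := by
  filter_upwards [ENNReal.ae_le_essSup (μ := volume.restrict Ω) (fun x => (u x).abs)] with x hx
  have h1 : (u x).abs ≠ ⊤ := (hx.trans_lt hu.2.1).ne
  refine EReal.coe_toReal (fun h => h1 ?_) (fun h => h1 ?_) <;> simp [h]

/-- Within distance r of Γ the weight gives the bound. Beyond it, the monotonicity argument is
applied to uφ and vφ, which are limits of test functions. -/
theorem ae_toReal_sub_le (hn : 2 ≤ n) {p : ℝ} (hp : 1 < p)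
    {Ω Γ : Set (EuclideanSpace ℝ (Fin n))} (hΩ : IsOpen Ω) (hΩb : Bornology.IsBounded Ω)
    (hΓ : IsClosed Γ) (hΓΩ : Γ ⊆ frontier Ω)
    {A : EuclideanSpace ℝ (Fin n) → EuclideanSpace ℝ (Fin n) → EuclideanSpace ℝ (Fin n)}
    (hA : IsPLaplaceType p Ω A) {νp νm : Measure Ω} {β : ℝ} (hβ : 0 < β)
    {u v : EuclideanSpace ℝ (Fin n) → EReal} (hu : IsAdmissible p β Ω Γ u)
    (hv : IsAdmissible p β Ω Γ v) (hsub : IsWeakSubsolution p Ω A νp νm (fun x => (u x).toReal))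
    (hsup : IsWeakSupersolution p Ω A νp νm (fun x => (v x).toReal)) {ε : ℝ} (hε : 0 < ε) :
    ∀ᵐ x ∂(volume.restrict Ω), (u x).toReal - (v x).toReal ≤ ε := by
  have hfin : IsFiniteMeasure (volume.restrict Ω) := ⟨by simpa using hΩb.measure_lt_top⟩
  have hP1 : 1 ≤ ENNReal.ofReal p := by simpa using hp.le
  obtain ⟨Gu, ⟨hGu, -⟩, hsub⟩ := hsub
  obtain ⟨Gv, ⟨hGv, -⟩, hsup⟩ := hsup
  obtain ⟨ru, hru, hur⟩ := hu.memLinftyWeighted.exists_ae_abs_toReal_le hβ hΩ hΓ hΓΩ (half_pos hε)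
  obtain ⟨rv, hrv, hvr⟩ := hv.memLinftyWeighted.exists_ae_abs_toReal_le hβ hΩ hΓ hΓΩ (half_pos hε)
  set r := min ru rv with hr
  have hr0 : 0 < r := lt_min hru hrv
  have hnear : ∀ᵐ x ∂(volume.restrict Ω), Metric.infEDist x Γ ≤ r →
      (u x).toReal - (v x).toReal ≤ ε := by
    filter_upwards [hur, hvr] with x h1 h2 hx
    have h3 := h1 (hx.trans (min_le_left _ _))
    have h4 := h2 (hx.trans (min_le_right _ _))
    rw [abs_le] at h3 h4
    linarith
  -- Radii r₁ < r₂ < r₃ < r: φ rises from 0 to 1 between r₁ and r₂, and η between r₃ and r. Hence φ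
  -- = 1 on a neighborhood of the support of η, where uφ and vφ have the gradients of u and v, while
  -- u - v ≤ ε wherever η is not yet 1.
  obtain ⟨r₃, hr₃0, hr₃⟩ := exists_between hr0
  obtain ⟨r₂, hr₂0, hr₂⟩ := exists_between hr₃0
  obtain ⟨r₁, hr₁0, hr₁⟩ := exists_between hr₂0
  have hcl : ∀ a : ℝ≥0∞, IsClosed {x | Metric.infEDist x Γ ≤ a} := fun a =>
    isClosed_le Metric.continuous_infEDist continuous_const
  have hcl' : ∀ a : ℝ≥0∞, IsClosed {x | a ≤ Metric.infEDist x Γ} := fun a =>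
    isClosed_le continuous_const Metric.continuous_infEDist
  have hdisj : ∀ {a b : ℝ≥0∞}, a < b →
      Disjoint {x | Metric.infEDist x Γ ≤ a} {x | b ≤ Metric.infEDist x Γ} := fun hab =>
    disjoint_left.2 fun x (hx : _ ≤ _) (hx' : _ ≤ _) => absurd (hx'.trans hx) (not_le.2 hab)
  obtain ⟨φ, hφ, hφ0, hφ1, hφn, hφle⟩ := exists_contDiff_zero_one (hcl r₁) (hcl' r₂) (hdisj hr₁)
  obtain ⟨η, hη, hη0, hη1, hηn, hηle⟩ := exists_contDiff_zero_one (hcl r₃) (hcl' r) (hdisj hr₃)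
  simp only [mem_ofPred_eq] at hφ0 hφ1 hη0 hη1
  have hΓnhd : ∃ V : Set (EuclideanSpace ℝ (Fin n)), IsOpen V ∧ Γ ⊆ V ∧ ∀ x ∈ V, φ x = 0 := by
    refine ⟨{x | Metric.infEDist x Γ < r₁}, isOpen_lt Metric.continuous_infEDist continuous_const,
      fun x hx => ?_, fun x hx => hφ0 x (le_of_lt hx)⟩
    simpa [Metric.infEDist_zero_of_mem hx] using hr₁0
  obtain ⟨G₁, hwG₁, hU, hG₁, f₁, hf₁, hfU, hfG₁⟩ := hu.memW1pCompl.2 φ hφ hΓnhd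
  obtain ⟨G₂, hwG₂, hV, hG₂, f₂, hf₂, hfV, hfG₂⟩ := hv.memW1pCompl.2 φ hφ hΓnhd
  have hO : IsOpen (Ω ∩ {x | r₂ < Metric.infEDist x Γ}) :=
    hΩ.inter (isOpen_lt continuous_const Metric.continuous_infEDist)
  have hG₁u := hGu.ae_eq hO inter_subset_left hwG₁ fun x hx => by
    rw [hφ1 x (le_of_lt hx.2), mul_one]
  have hG₂v := hGv.ae_eq hO inter_subset_left hwG₂ fun x hx => by
    rw [hφ1 x (le_of_lt hx.2), mul_one]
  have hsupp : tsupport η ⊆ {x | r₂ < Metric.infEDist x Γ} := by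
    refine (closure_minimal (t := {x | r₃ ≤ Metric.infEDist x Γ}) (fun x hx => ?_)
      (hcl' r₃)).trans fun x (hx : _ ≤ _) => hr₂.trans_le hx
    by_contra hlt
    exact hx (hη0 x (not_le.1 hlt).le)
  set h : EuclideanSpace ℝ (Fin n) → ℝ := fun x => (u x).toReal * φ x - (v x).toReal * φ x with hh
  have hnear' : ∀ᵐ x ∂(volume.restrict Ω), Metric.infEDist x Γ ≤ r → h x ≤ ε := by
    filter_upwards [hnear] with x hx hxr
    have h1 := mul_le_mul_of_nonneg_right (hx hxr) (hφn x)
    have h2 := mul_le_of_le_one_right hε.le (hφle x)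
    rw [sub_mul] at h1
    exact h1.trans h2
  have hae : ∀ᵐ x ∂(volume.restrict Ω), h x ≤ ε := by
    refine hA.ae_le_of_test hn hp hΩ hΩb (h := h) (f := fun k x => f₁ k x - f₂ k x)
      (G₁ := G₁) (G₂ := G₂) (η := η) (fun k => ?_) (hU.1.sub hV.1) hG₁ hG₂ ?_ ?_ hη hηn hηle hε ?_ ?_
    · refine ⟨(hf₁ k).1.sub (hf₂ k).1, (hf₁ k).2.1.sub (hf₂ k).2.1, ?_⟩
      exact (tsupport_sub _ _).trans (union_subset (hf₁ k).2.2 (hf₂ k).2.2)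
    · have h1 := hfU.add hfV
      rw [add_zero] at h1
      refine tendsto_of_tendsto_of_tendsto_of_le_of_le tendsto_const_nhds h1 (fun _ => zero_le)
        fun k => ?_
      have h2 : (fun x => f₁ k x - f₂ k x - h x) = (fun x => f₁ k x - (u x).toReal * φ x) -
          fun x => f₂ k x - (v x).toReal * φ x := by
        ext x
        simp only [hh, Pi.sub_apply]
        ring
      rw [h2]
      exact eLpNorm_sub_le ((hf₁ k).1.continuous.aestronglyMeasurable.sub hU.1)
        ((hf₂ k).1.continuous.aestronglyMeasurable.sub hV.1) hP1
    · have h1 := hfG₁.add hfG₂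
      rw [add_zero] at h1
      refine tendsto_of_tendsto_of_tendsto_of_le_of_le tendsto_const_nhds h1 (fun _ => zero_le)
        fun k => ?_
      have h2 : (fun x => gradient (fun x => f₁ k x - f₂ k x) x - (G₁ x - G₂ x)) =
          (fun x => gradient (f₁ k) x - G₁ x) - fun x => gradient (f₂ k) x - G₂ x := by
        ext1 x
        rw [gradient_fun_sub ((hf₁ k).1.differentiable (by simp) x)
          ((hf₂ k).1.differentiable (by simp) x)]
        simp only [Pi.sub_apply]
        abel
      rw [h2]
      exact eLpNorm_sub_le ((continuous_gradient (hf₁ k).1).aestronglyMeasurable.sub hG₁.1)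
        ((continuous_gradient (hf₂ k).1).aestronglyMeasurable.sub hG₂.1) hP1
    · filter_upwards [hnear'] with x hx
      rcases le_or_gt (Metric.infEDist x Γ) r with hxr | hxr
      · exact Or.inl (hx hxr)
      · refine Or.inr ⟨hη1 x hxr.le, ?_⟩
        have : η =ᶠ[𝓝 x] fun _ => 1 := by
          filter_upwards [(isOpen_lt continuous_const Metric.continuous_infEDist).mem_nhds hxr]
            with y hy
          exact hη1 y (le_of_lt hy)
        rw [this.gradient_eq, gradient_fun_const]
    · intro ψ hψ hψ0
      have hζ : IsTest Ω fun y => η y * ψ y :=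
        ⟨hη.mul hψ.1, hψ.2.1.mul_left, tsupport_mul_subset_right.trans hψ.2.2⟩
      have hζ0 : ∀ x, 0 ≤ η x * ψ x := fun x => mul_nonneg (hηn x) (hψ0 x)
      have hζs : ∀ x, x ∉ {x | r₂ < Metric.infEDist x Γ} →
          gradient (fun y => η y * ψ y) x = 0 := fun x hx =>
        gradient_eq_zero_of_notMem_tsupport fun h => hx (hsupp (tsupport_mul_subset_left h))
      have heq : ∀ {G G' : EuclideanSpace ℝ (Fin n) → EuclideanSpace ℝ (Fin n)},
          (∀ᵐ x, x ∈ Ω ∩ {x | r₂ < Metric.infEDist x Γ} → G x = G' x) →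
          ∫ x in Ω, inner ℝ (A x (G x)) (gradient (fun y => η y * ψ y) x) =
            ∫ x in Ω, inner ℝ (A x (G' x)) (gradient (fun y => η y * ψ y) x) := by
        intro G G' hGG'
        refine integral_congr_ae ?_
        filter_upwards [ae_restrict_of_ae hGG', ae_restrict_mem hΩ.measurableSet] with x hx hxΩ
        by_cases hxr : x ∈ {x | r₂ < Metric.infEDist x Γ}
        · rw [hx ⟨hxΩ, hxr⟩]
        · rw [hζs x hxr, inner_zero_right, inner_zero_right]
      -- Both inequalities are tested with the same function, so the terms with ν cancel on
      -- subtraction.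
      have h1 := hsub _ hζ hζ0
      have h2 := hsup _ hζ hζ0
      rw [heq hG₁u] at h1
      rw [heq hG₂v] at h2
      have hpq : (p / (p - 1)).HolderConjugate p := (Real.HolderConjugate.conjExponent hp).symm
      simp only [inner_sub_left]
      rw [integral_sub
        (integrable_inner_of_holderConjugate hpq (hA.memLp hp hΩ hG₁) (hζ.memLp_gradient _ _))
        (integrable_inner_of_holderConjugate hpq (hA.memLp hp hΩ hG₂) (hζ.memLp_gradient _ _))]
      linarith
  filter_upwards [hnear, hae] with x h1 h2
  rcases le_or_gt (Metric.infEDist x Γ) r with hxr | hxr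
  · exact h1 hxr
  · have h3 : r₂ ≤ Metric.infEDist x Γ := ((hr₂.trans hr₃).trans hxr).le
    simpa [hh, hφ1 x h3] using h2

/-- The comparison principle, almost everywhere. -/
theorem ae_le_of_isWeakSubsolution_of_isWeakSupersolution (hn : 2 ≤ n) {p : ℝ} (hp : 1 < p)
    {Ω Γ : Set (EuclideanSpace ℝ (Fin n))} (hΩ : IsOpen Ω) (hΩb : Bornology.IsBounded Ω)
    (hΓ : IsClosed Γ) (hΓΩ : Γ ⊆ frontier Ω)
    {A : EuclideanSpace ℝ (Fin n) → EuclideanSpace ℝ (Fin n) → EuclideanSpace ℝ (Fin n)}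
    (hA : IsPLaplaceType p Ω A) {νp νm : Measure Ω} {β : ℝ} (hβ : 0 < β)
    {u v : EuclideanSpace ℝ (Fin n) → EReal} (hu : IsAdmissible p β Ω Γ u)
    (hv : IsAdmissible p β Ω Γ v) (hsub : IsWeakSubsolution p Ω A νp νm (fun x => (u x).toReal))
    (hsup : IsWeakSupersolution p Ω A νp νm (fun x => (v x).toReal)) :
    ∀ᵐ x ∂(volume.restrict Ω), u x ≤ v x := by
  have h1 : ∀ k : ℕ, ∀ᵐ x ∂(volume.restrict Ω),
      (u x).toReal - (v x).toReal ≤ 1 / ((k : ℝ) + 1) := fun k =>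
    ae_toReal_sub_le hn hp hΩ hΩb hΓ hΓΩ hA hβ hu hv hsub hsup (by positivity)
  filter_upwards [ae_all_iff.2 h1, hu.memLinftyWeighted.ae_coe_toReal,
    hv.memLinftyWeighted.ae_coe_toReal] with x hx hux hvx
  have h2 := ge_of_tendsto' (tendsto_one_div_add_atTop_nhds_zero_nat (𝕜 := ℝ)) hx
  rw [← hux, ← hvx, EReal.coe_le_coe_iff]
  linarith

theorem IsWeakSolution.isWeakSubsolution {p : ℝ} {Ω : Set (EuclideanSpace ℝ (Fin n))}
    {A : EuclideanSpace ℝ (Fin n) → EuclideanSpace ℝ (Fin n) → EuclideanSpace ℝ (Fin n)}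
    {νp νm : Measure Ω} {f : EuclideanSpace ℝ (Fin n) → ℝ} (h : IsWeakSolution p Ω A νp νm f) :
    IsWeakSubsolution p Ω A νp νm f := by
  obtain ⟨G, hG, heq⟩ := h
  exact ⟨G, hG, fun φ hφ _ => (heq φ hφ).le⟩

theorem IsWeakSolution.isWeakSupersolution {p : ℝ} {Ω : Set (EuclideanSpace ℝ (Fin n))}
    {A : EuclideanSpace ℝ (Fin n) → EuclideanSpace ℝ (Fin n) → EuclideanSpace ℝ (Fin n)}
    {νp νm : Measure Ω} {f : EuclideanSpace ℝ (Fin n) → ℝ} (h : IsWeakSolution p Ω A νp νm f) :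
    IsWeakSupersolution p Ω A νp νm f := by
  obtain ⟨G, hG, heq⟩ := h
  exact ⟨G, hG, fun φ hφ _ => (heq φ hφ).ge⟩

end Main

end ComparisonPrinciple

end

theorem theorem4p2 {n : ℕ} (hn : 2 ≤ n) {p : ℝ} (hp : 1 < p) (hpn : p ≤ n)
    {Ω Γ : Set (EuclideanSpace ℝ (Fin n))}
    (hΩ : IsOpen Ω) (hΩb : Bornology.IsBounded Ω)
    (hΓ : IsClosed Γ) (hΓΩ : Γ ⊆ frontier Ω)
    {A : EuclideanSpace ℝ (Fin n) → EuclideanSpace ℝ (Fin n) → EuclideanSpace ℝ (Fin n)}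
    (hA : ComparisonPrinciple.IsPLaplaceType p Ω A)
    (νp νm : Measure Ω) [IsFiniteMeasureOnCompacts νp] [IsFiniteMeasureOnCompacts νm]
    {β : ℝ} (hβ : 0 < β) {u v : EuclideanSpace ℝ (Fin n) → EReal}
    (hu : ComparisonPrinciple.IsAdmissible p β Ω Γ u)
    (hv : ComparisonPrinciple.IsAdmissible p β Ω Γ v) :
    (ComparisonPrinciple.IsWeakSubsolution p Ω A νp νm (fun x => (u x).toReal) →
      ComparisonPrinciple.IsWeakSupersolution p Ω A νp νm (fun x => (v x).toReal) →
      ComparisonPrinciple.Quasieverywhere p Ω (fun x => u x ≤ v x)) ∧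
    (ComparisonPrinciple.IsWeakSolution p Ω A νp νm (fun x => (u x).toReal) →
      ComparisonPrinciple.IsWeakSolution p Ω A νp νm (fun x => (v x).toReal) →
      ComparisonPrinciple.Quasieverywhere p Ω (fun x => u x = v x)) := by
  constructor
  · intro hsub hsup
    have hae := ComparisonPrinciple.ae_le_of_isWeakSubsolution_of_isWeakSupersolution hn hp hΩ hΩb
      hΓ hΓΩ hA hβ hu hv hsub hsup
    have hR : IsOpen {z : EReal × EReal | z.2 < z.1} := isOpen_lt continuous_snd continuous_fst
    simpa using hu.quasicontinuous.quasieverywhere_notMem hp.le hΩ hΩb hv.quasicontinuous hR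
      (hae.mono fun x hx => not_lt.2 hx)
  · intro hsu hsv
    have h1 := ComparisonPrinciple.ae_le_of_isWeakSubsolution_of_isWeakSupersolution hn hp hΩ hΩb
      hΓ hΓΩ hA hβ hu hv hsu.isWeakSubsolution hsv.isWeakSupersolution
    have h2 := ComparisonPrinciple.ae_le_of_isWeakSubsolution_of_isWeakSupersolution hn hp hΩ hΩb
      hΓ hΓΩ hA hβ hv hu hsv.isWeakSubsolution hsu.isWeakSupersolution
    -- Inequality of the values is itself an open relation, so no union of two exceptional sets has
    -- to be formed.
    have hR : IsOpen {z : EReal × EReal | z.1 ≠ z.2} :=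
      isOpen_ne_fun continuous_fst continuous_snd
    have h3 : ∀ᵐ x ∂(volume.restrict Ω), (u x, v x) ∉ {z : EReal × EReal | z.1 ≠ z.2} := by
      filter_upwards [h1, h2] with x hx hx'
      exact not_not.2 (le_antisymm hx hx')
    simpa using hu.quasicontinuous.quasieverywhere_notMem hp.le hΩ hΩb hv.quasicontinuous hR h3
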